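/- Let $G$ be a finite simple maximal planar graph (planar, and no edge can be added without destroying planarity) with chromatic number $4$ and minimum degree $\delta(G)\ge 4$, drawn in the plane with edges as polygonal arcs that meet only at their common ends. For a (proper) $4$-coloring $g$ of $G$ and a cycle $C$ of $G$ let $g(C)$ be the set of colours that $g$ uses on $V(C)$; $C$ is a bichromatic cycle of $g$ if $|g(C)|=2$. For a bichromatic cycle $C$ of $g$, let $\sigma(g,C)$ be the $4$-coloring obtained from $g$ by interchanging the two colours not in $g(C)$ at all vertices in the interior of $C$. The Kempe-equivalence class $F^f(G)$ of a $4$-coloring $f$ is the set of all $4$-colorings obtained from $f$ by a finite sequence of such $\sigma$-operations, colorings that differ only by a permutation of the colours not being distinguished. A bichromatic cycle $C$ of $f$ is called an unchanged bichromatic cycle (UB-cycle) of $f$ if $|f'(C)|=2$ for every $f'\in F^f(G)$. Two cycles are intersecting if each of them has a vertex in the interior of the other, and nonintersecting otherwise. Let $f$ be a $4$-coloring of $G$ and let $C$ be a bichromatic cycle of $f$. Then $C$ is a UB-cycle of $f$ if and only if, for every $f'\in F^f(G)$ and every bichromatic cycle $C'$ of $f'$ with $f'(C')\ne f'(C)$,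 the cycles $C$ and $C'$ are nonintersecting. -/

import Mathlib

namespace KempeCycle

/-- The Euclidean plane. -/
abbrev Plane : Type := EuclideanSpace ℝ (Fin 2)

/-- `A` is a polygonal arc from `a` to `b`: a union of finitely many straight segments
`[p 0, p 1], [p 1, p 2], …, [p (m-1), p m]` (with `m ≥ 1`, `p 0 = a`, `p m = b`) that does not
meet itself: the `p i` are distinct, consecutive segments meet only in their common endpoint, and
other segments are disjoint. -/
def IsPolygonalArc (a b : Plane) (A : Set Plane) : Prop :=
  ∃ (m : ℕ) (p : ℕ → Plane), 1 ≤ m ∧ p 0 = a ∧ p m = b ∧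
    Set.InjOn p (Set.Iic m) ∧
    (∀ i < m, ∀ j < m, i < j →
      segment ℝ (p i) (p (i + 1)) ∩ segment ℝ (p j) (p (j + 1)) ⊆ {x | j = i + 1 ∧ x = p j}) ∧
    A = ⋃ i ∈ Set.Iio m, segment ℝ (p i) (p (i + 1))

/-- A drawing of `G` in the plane in which edges meet only at their common ends: vertices are
distinct points, every edge is a polygonal arc joining its ends and containing no other vertex, and
two different edges have only the points of their common ends in common.
(The values of `arc` at non-edges are irrelevant.) -/
structure PlaneDrawing {V : Type*} (G : SimpleGraph V) where
  point : V → Plane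
  arc : Sym2 V → Set Plane
  point_injective : Function.Injective point
  isPolygonalArc_arc : ∀ u v, G.Adj u v → IsPolygonalArc (point u) (point v) (arc s(u, v))
  mem_of_point_mem_arc : ∀ e ∈ G.edgeSet, ∀ w, point w ∈ arc e → w ∈ e
  arc_inter_arc : ∀ e ∈ G.edgeSet, ∀ e' ∈ G.edgeSet, e ≠ e' →
    arc e ∩ arc e' ⊆ point '' {w | w ∈ e ∧ w ∈ e'}

/-- A graph is planar if it can be drawn in the plane. -/
def IsPlanar {V : Type*} (G : SimpleGraph V) : Prop := Nonempty (PlaneDrawing G)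

/-- A maximal planar graph: planar, and adding any new edges (between existing vertices) destroys
planarity. -/
def IsMaximalPlanar {V : Type*} (G : SimpleGraph V) : Prop :=
  IsPlanar G ∧ ∀ H : SimpleGraph V, G < H → ¬ IsPlanar H

/-- A cycle of `G`, given as a closed walk without repetitions. -/
structure Cycle {V : Type*} (G : SimpleGraph V) where
  base : V
  walk : G.Walk base base
  isCycle : walk.IsCycle

/-- The vertex set of a cycle. -/
def Cycle.verts {V : Type*} {G : SimpleGraph V} (C : Cycle G) : Set V := {v | v ∈ C.walk.support}

/-- The closed curve that draws the cycle `C`. -/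
def PlaneDrawing.curve {V : Type*} {G : SimpleGraph V} (D : PlaneDrawing G) (C : Cycle G) :
    Set Plane :=
  ⋃ e ∈ {e | e ∈ C.walk.edges}, D.arc e

/-- The vertices in the interior of the cycle `C`: those drawn off the curve of `C`, in a bounded
component of the complement of that curve. -/
def PlaneDrawing.interiorVerts {V : Type*} {G : SimpleGraph V} (D : PlaneDrawing G)
    (C : Cycle G) : Set V :=
  {v | D.point v ∉ D.curve C ∧
    Bornology.IsBounded (connectedComponentIn (D.curve C)ᶜ (D.point v))}

/-- Two cycles are intersecting if each has a vertex in the interior of the other. -/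
def PlaneDrawing.Intersecting {V : Type*} {G : SimpleGraph V} (D : PlaneDrawing G)
    (C C' : Cycle G) : Prop :=
  (C.verts ∩ D.interiorVerts C').Nonempty ∧ (C'.verts ∩ D.interiorVerts C).Nonempty

/-- The set of colours that `f` uses on the cycle `C`. -/
def colorsOn {V : Type*} {G : SimpleGraph V} (f : G.Coloring (Fin 4)) (C : Cycle G) :
    Set (Fin 4) := f '' C.verts

/-- `C` is a bichromatic cycle of `f`. -/
def IsBichromatic {V : Type*} {G : SimpleGraph V} (f : G.Coloring (Fin 4)) (C : Cycle G) : Prop :=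
  (colorsOn f C).ncard = 2

/-- `g` is the coloring `σ(f, C)`: `C` is a bichromatic cycle of `f`, and `g` arises from `f` by
interchanging, at all vertices in the interior of `C`, the two colours `s`, `t` not used on `C`. -/
def PlaneDrawing.IsSigma {V : Type*} {G : SimpleGraph V} (D : PlaneDrawing G)
    (f : G.Coloring (Fin 4)) (C : Cycle G) (g : G.Coloring (Fin 4)) : Prop :=
  IsBichromatic f C ∧
  ∃ s t : Fin 4, s ≠ t ∧ (colorsOn f C)ᶜ = {s, t} ∧
    ∀ v, (v ∈ D.interiorVerts C → g v = Equiv.swap s t (f v)) ∧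
      (v ∉ D.interiorVerts C → g v = f v)

/-- The Kempe-equivalence class of `f`: all 4-colorings obtained from `f` by a finite sequence of
`σ`-operations. Colorings that differ by a permutation of the colours only (that is, that have the
same partition into colour classes) are not distinguished, so the class is closed under such
permutations. -/
def PlaneDrawing.kempeClass {V : Type*} {G : SimpleGraph V} (D : PlaneDrawing G)
    (f : G.Coloring (Fin 4)) : Set (G.Coloring (Fin 4)) :=
  {g | ∃ h, Relation.ReflTransGen (fun f₁ f₂ => ∃ C, D.IsSigma f₁ C f₂) f h ∧
    ∃ π : Equiv.Perm (Fin 4), ∀ v, g v = π (h v)}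

/-- `C` is an unchanged bichromatic cycle of `f`: it is a bichromatic cycle of `f`, and it carries
exactly two colours under every coloring in the Kempe-equivalence class of `f`. -/
def PlaneDrawing.IsUBCycle {V : Type*} {G : SimpleGraph V} (D : PlaneDrawing G)
    (f : G.Coloring (Fin 4)) (C : Cycle G) : Prop :=
  IsBichromatic f C ∧ ∀ f' ∈ D.kempeClass f, (colorsOn f' C).ncard = 2

end KempeCycle

/-! Everything rests on where one cycle lies relative to another, and the full Jordan curve theorem
is not needed. Three facts about the curve of a cycle suffice: its complement has an unbounded
component, it has a bounded one (`exists_bounded`), and every component has the whole curve in its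
closure (`curve_subset_closure`). The second comes from a winding number. The third holds because
the curve is connected and near each of its points consists of just two rays.

If a bichromatic C' of f' intersects C and has other colours, take a colour b on C that is not on
C'. Each edge of C has a b-coloured end, which is off C'. If all these ends were inside C', an
unbounded component of the complement of C' would miss C, and through it every vertex of C' off C
could escape to infinity, so none would be inside C (`inter_interiorVerts_eq_empty`). So C has
b-coloured vertices both inside and not inside C'. Disjoint colour pairs would put C on one side of
C'. With a shared colour, σ at C' gives C three colours: the shared one, b, and the partner of b.
Hence C is not a UB-cycle.

Conversely, C stays bichromatic through each σ-step. Nothing on C changes if C' has the same colours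
or no vertex of C is inside C'. Otherwise no vertex of C' is inside C, a bounded component of the
complement of C misses C', and all of C off C' is on the same side of C'
(`mem_interiorVerts_of_disjoint`). The step then acts on C as a single permutation of the colours.
-/

namespace KempeCycle
open Set Filter Topology

/-! ### Local shape of a set near a point: finitely many rays. -/

section Stars

/-- Near `x`, the set `A` consists of the open rays from `x` in the directions `F`, up to
possibly the point `x` itself. -/
def HasStarAt (A : Set Plane) (x : Plane) (F : Set Plane) : Prop :=
  ∀ᶠ y in 𝓝[≠] x, y ∈ A ↔ ∃ f ∈ F, SameRay ℝ f (y - x)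

lemma HasStarAt.union {A B F F' : Set Plane} {x : Plane} (hA : HasStarAt A x F)
    (hB : HasStarAt B x F') : HasStarAt (A ∪ B) x (F ∪ F') := by
  filter_upwards [hA, hB] with y h1 h2
  simp only [mem_union, h1, h2, or_and_right, exists_or]

lemma HasStarAt.union_isClosed {A B F : Set Plane} {x : Plane} (hA : HasStarAt A x F)
    (hB : IsClosed B) (hx : x ∉ B) : HasStarAt (A ∪ B) x F := by
  have h : ∀ᶠ y in 𝓝[≠] x, y ∈ Bᶜ :=
    Filter.Eventually.filter_mono nhdsWithin_le_nhds (hB.isOpen_compl.eventually_mem hx)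
  filter_upwards [hA, h] with y h1 h2
  rw [← h1, mem_union, or_iff_left h2]

lemma hasStarAt_segment_left {a b : Plane} (hab : a ≠ b) :
    HasStarAt (segment ℝ a b) a {b - a} := by
  have hb : b - a ≠ 0 := sub_ne_zero.2 hab.symm
  have h : ∀ᶠ y in 𝓝[≠] a, ‖y - a‖ < ‖b - a‖ := by
    refine Filter.Eventually.filter_mono nhdsWithin_le_nhds ?_
    have : Tendsto (fun y : Plane => ‖y - a‖) (𝓝 a) (𝓝 0) := by
      have : Continuous fun y : Plane => ‖y - a‖ := by fun_prop
      simpa using this.tendsto a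
    exact this.eventually (gt_mem_nhds (norm_pos_iff.2 hb))
  filter_upwards [h, self_mem_nhdsWithin] with y hy hya
  simp only [mem_singleton_iff, exists_eq_left]
  constructor
  · rw [mem_segment_iff_wbtw]
    intro hw
    simpa using hw.sameRay_vsub_left.symm
  · intro hs
    obtain ⟨r, hr, hry⟩ := (exists_pos_left_iff_sameRay hb (sub_ne_zero.2 hya)).2 hs
    rw [← hry, norm_smul, Real.norm_eq_abs, abs_of_pos hr] at hy
    have hr1 : r < 1 := by
      by_contra hc
      have := mul_le_mul_of_nonneg_right (not_lt.1 hc) (norm_nonneg (b - a))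
      linarith
    rw [segment_eq_image']
    exact ⟨r, ⟨hr.le, hr1.le⟩, by simp only [hry]; abel⟩

lemma hasStarAt_segment_right {a b : Plane} (hab : a ≠ b) :
    HasStarAt (segment ℝ a b) b {a - b} := by
  rw [segment_symm]
  exact hasStarAt_segment_left hab.symm

lemma segment_eq_union {a b x : Plane} (hx : x ∈ segment ℝ a b) :
    segment ℝ a b = segment ℝ x a ∪ segment ℝ x b := by
  apply subset_antisymm
  · rw [segment_eq_image'] at hx ⊢
    obtain ⟨s, hs, rfl⟩ := hx
    rintro _ ⟨t, ht, rfl⟩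
    have key : ∀ r : ℝ, a + r • (b - a) = AffineMap.lineMap a b r := fun r => by
      simp [AffineMap.lineMap_apply, add_comm]
    simp only [key]
    rcases le_total t s with h | h
    · left
      rw [segment_symm, ← AffineMap.lineMap_apply_zero (k := ℝ) a b]
      rw [AffineMap.lineMap_apply_zero, mem_segment_iff_wbtw,
        show Wbtw ℝ a (AffineMap.lineMap a b t) (AffineMap.lineMap a b s) ↔
          Wbtw ℝ (AffineMap.lineMap a b (0 : ℝ)) (AffineMap.lineMap a b t)
            (AffineMap.lineMap a b s) by rw [AffineMap.lineMap_apply_zero]]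
      exact Wbtw.map (wbtw_iff_of_le (ht.1.trans h) |>.2 ⟨ht.1, h⟩) (AffineMap.lineMap a b)
    · right
      rw [mem_segment_iff_wbtw,
        show Wbtw ℝ (AffineMap.lineMap a b s) (AffineMap.lineMap a b t) b ↔
          Wbtw ℝ (AffineMap.lineMap a b s) (AffineMap.lineMap a b t)
            (AffineMap.lineMap a b (1 : ℝ)) by rw [AffineMap.lineMap_apply_one]]
      exact Wbtw.map (wbtw_iff_of_le (h.trans ht.2) |>.2 ⟨h, ht.2⟩) (AffineMap.lineMap a b)
  · have hc := convex_segment (𝕜 := ℝ) a b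
    exact union_subset (hc.segment_subset hx (left_mem_segment ℝ a b))
      (hc.segment_subset hx (right_mem_segment ℝ a b))

/-- Near `x`, the set `A` consists of two different rays from `x`. -/
def IsTwoRayAt (A : Set Plane) (x : Plane) : Prop :=
  ∃ u v : Plane, u ≠ 0 ∧ v ≠ 0 ∧ ¬ SameRay ℝ u v ∧ HasStarAt A x {u, v}

lemma isTwoRayAt_segment {a b x : Plane} (hx : x ∈ segment ℝ a b) (ha : x ≠ a) (hb : x ≠ b) :
    IsTwoRayAt (segment ℝ a b) x := by
  have ha' : a - x ≠ 0 := sub_ne_zero.2 ha.symm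
  have hb' : b - x ≠ 0 := sub_ne_zero.2 hb.symm
  refine ⟨a - x, b - x, ha', hb', fun h => ?_, ?_⟩
  · have h1 : SameRay ℝ (x - a) (b - x) := by
      simpa using (mem_segment_iff_wbtw.1 hx).sameRay_vsub
    have h2 : SameRay ℝ (a - x) (x - a) := h.trans h1.symm fun h0 => absurd h0 hb'
    rw [← neg_sub a x] at h2
    exact ha' (eq_zero_of_sameRay_self_neg h2)
  · rw [segment_eq_union hx]
    exact (hasStarAt_segment_left ha).union (hasStarAt_segment_left hb)

lemma IsTwoRayAt.union_isClosed {A B : Set Plane} {x : Plane} (hA : IsTwoRayAt A x)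
    (hB : IsClosed B) (hx : x ∉ B) : IsTwoRayAt (A ∪ B) x := by
  obtain ⟨u, v, hu, hv, huv, h⟩ := hA
  exact ⟨u, v, hu, hv, huv, h.union_isClosed hB hx⟩

lemma frequently_sameRay (x : Plane) {u : Plane} (hu : u ≠ 0) :
    ∃ᶠ y in 𝓝[≠] x, SameRay ℝ u (y - x) := by
  have h : Tendsto (fun t : ℝ => x + t • u) (𝓝[>] 0) (𝓝[≠] x) := by
    apply tendsto_nhdsWithin_of_tendsto_nhds_of_eventually_within
    · have : Continuous fun t : ℝ => x + t • u := by fun_prop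
      simpa using (this.tendsto 0).mono_left nhdsWithin_le_nhds
    · filter_upwards [self_mem_nhdsWithin] with t ht
      simp only [mem_compl_iff, mem_singleton_iff, add_eq_left, smul_eq_zero, not_or]
      exact ⟨ne_of_gt ht, hu⟩
  refine h.frequently (Eventually.frequently ?_)
  filter_upwards [self_mem_nhdsWithin] with t ht
  simpa using SameRay.sameRay_nonneg_smul_right (R := ℝ) (S := ℝ) u (le_of_lt (mem_Ioi.1 ht))

/-- If both directions lay on one ray, that ray would belong to A and to B arbitrarily close to x,
and the two sets would meet outside x. -/
lemma HasStarAt.isTwoRayAt_union {A B : Set Plane} {x u v : Plane} (hA : HasStarAt A x {u})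
    (hB : HasStarAt B x {v}) (hu : u ≠ 0) (hv : v ≠ 0) (hAB : A ∩ B ⊆ {x}) :
    IsTwoRayAt (A ∪ B) x := by
  refine ⟨u, v, hu, hv, fun huv => ?_, hA.union hB⟩
  obtain ⟨y, hy, h1, h2, hyx⟩ := ((frequently_sameRay x hu).and_eventually
    (hA.and (hB.and self_mem_nhdsWithin))).exists
  simp only [mem_singleton_iff, exists_eq_left] at h1 h2
  exact hyx (hAB ⟨h1.2 hy, h2.2 (huv.symm.trans hy fun h => absurd h hu)⟩)

end Stars

/-! ### Components of the complement and their boundary. -/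

section Boundary
open Complex

/-- The Euclidean plane as the complex plane. -/
noncomputable def toComplex : Plane ≃ₗᵢ[ℝ] ℂ := Complex.orthonormalBasisOneI.repr.symm

/-- A point avoiding the two rays from `0` with arguments `π` and `β` lies with its sector. -/
lemma exists_sector {ε β : ℝ} (hβ : β ∈ Ioo (-Real.pi) Real.pi) {y : ℂ} (hy0 : y ≠ 0)
    (hyε : ‖y‖ < ε) (hy1 : y.arg ≠ Real.pi) (hy2 : y.arg ≠ β) :
    ∃ S : Set ℂ, IsPreconnected S ∧ y ∈ S ∧
      (∀ z ∈ S, z ≠ 0 ∧ ‖z‖ < ε ∧ z.arg ≠ Real.pi ∧ z.arg ≠ β) ∧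
      ∀ z : ℂ, z ≠ 0 → ‖z‖ < ε → z.arg = Real.pi ∨ z.arg = β → z ∈ closure S := by
  have hε : 0 < ε := (norm_nonneg y).trans_lt hyε
  let φ : ℝ × ℝ → ℂ := fun p => p.1 * exp (p.2 * I)
  have hφ : Continuous φ := by fun_prop
  have hφz : ∀ z : ℂ, φ (‖z‖, z.arg) = z := norm_mul_exp_arg_mul_I
  have harg : ∀ p : ℝ × ℝ, 0 < p.1 → p.2 ∈ Ioc (-Real.pi) Real.pi → (φ p).arg = p.2 := by
    intro p h1 h2
    simp only [φ, exp_mul_I]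
    exact arg_mul_cos_add_sin_mul_I h1 h2
  have hnorm : ∀ p : ℝ × ℝ, 0 < p.1 → ‖φ p‖ = p.1 := by
    intro p h1
    simp [φ, abs_of_pos h1, Complex.norm_exp]
  -- The sector is the image of a rectangle in polar coordinates. The angles -π and π give the same
  -- ray, so each of the intervals (-π, β) and (β, π) is bounded by both rays.
  have main : ∀ a b : ℝ, -Real.pi ≤ a → b ≤ Real.pi → a < b → β ∉ Ioo a b → y.arg ∈ Ioo a b →
      (β = a ∨ β = b) → (a = -Real.pi ∨ b = Real.pi) →
      ∃ S : Set ℂ, IsPreconnected S ∧ y ∈ S ∧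
      (∀ z ∈ S, z ≠ 0 ∧ ‖z‖ < ε ∧ z.arg ≠ Real.pi ∧ z.arg ≠ β) ∧
      ∀ z : ℂ, z ≠ 0 → ‖z‖ < ε → z.arg = Real.pi ∨ z.arg = β → z ∈ closure S := by
    intro a b ha hb hab hβab hyab hβ' hπ
    refine ⟨φ '' (Ioo 0 ε ×ˢ Ioo a b), ?_, ?_, ?_, ?_⟩
    · exact (isPreconnected_Ioo.prod isPreconnected_Ioo).image _ hφ.continuousOn
    · exact ⟨(‖y‖, y.arg), ⟨⟨norm_pos_iff.2 hy0, hyε⟩, hyab⟩, hφz y⟩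
    · rintro _ ⟨⟨r, θ⟩, ⟨⟨hr, hr'⟩, hθ⟩, rfl⟩
      have h1 := harg (r, θ) hr ⟨by linarith [hθ.1], by linarith [hθ.2]⟩
      have h2 := hnorm (r, θ) hr
      simp only at hr hr' hθ
      rw [h1]
      refine ⟨norm_pos_iff.1 (by rwa [h2]), by rwa [h2], by linarith [hθ.2], ?_⟩
      rintro rfl
      exact hβab hθ
    · intro z hz0 hzε hz
      apply image_closure_subset_closure_image hφ
      rw [closure_prod_eq, closure_Ioo hε.ne, closure_Ioo hab.ne]
      have hmem : ‖z‖ ∈ Icc 0 ε := ⟨norm_nonneg z, hzε.le⟩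
      rcases hz with hz | hz
      · rcases hπ with rfl | rfl
        · refine ⟨(‖z‖, -Real.pi), ⟨hmem, left_mem_Icc.2 hab.le⟩, ?_⟩
          have := hφz z
          rw [hz] at this
          rw [← this]
          simp [φ, exp_neg]
        · exact ⟨(‖z‖, Real.pi), ⟨hmem, right_mem_Icc.2 hab.le⟩, hz ▸ hφz z⟩
      · refine ⟨(‖z‖, β), ⟨hmem, ?_⟩, hz ▸ hφz z⟩
        rcases hβ' with rfl | rfl
        · exact left_mem_Icc.2 hab.le
        · exact right_mem_Icc.2 hab.le
  have hylt : y.arg < Real.pi := lt_of_le_of_ne (arg_le_pi y) hy1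
  rcases lt_or_gt_of_ne hy2 with h | h
  · exact main (-Real.pi) β le_rfl hβ.2.le hβ.1 (by simp) ⟨neg_pi_lt_arg y, h⟩ (.inr rfl)
      (.inl rfl)
  · exact main β Real.pi hβ.1.le le_rfl hβ.2 (by simp) ⟨h, hylt⟩ (.inl rfl) (.inr rfl)

/-- Near a point where a set is two different rays, each local component of the complement has
the set in its closure. -/
lemma IsTwoRayAt.exists_isPreconnected {P : Set Plane} {x : Plane} (h : IsTwoRayAt P x)
    (hx : x ∈ P) :
    ∃ ε > 0, ∀ y ∈ Metric.ball x ε, y ∉ P → ∃ S : Set Plane, IsPreconnected S ∧ y ∈ S ∧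
      S ⊆ Pᶜ ∧ ∀ z ∈ Metric.ball x ε, z ∈ P → z ≠ x → z ∈ closure S := by
  obtain ⟨u, v, hu, hv, huv, hstar⟩ := h
  obtain ⟨ε, hε, hball⟩ := Metric.eventually_nhds_iff.1 (eventually_nhdsWithin_iff.1 hstar)
  refine ⟨ε, hε, fun y hy hyP => ?_⟩
  -- Dividing by this unit number turns u onto the negative real axis, the branch cut of `arg`.
  let κ : ℂ := -toComplex u / ‖u‖
  have hu' : toComplex u ≠ 0 := by simpa using hu
  have hun : (‖u‖ : ℂ) ≠ 0 := by simpa using hu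
  have hκ : ‖κ‖ = 1 := by
    simp only [κ, norm_div, norm_neg, LinearIsometryEquiv.norm_map, Complex.norm_real,
      norm_norm]
    exact div_self (norm_ne_zero_iff.2 hu)
  have hκ0 : κ ≠ 0 := by
    intro h0
    simp [h0] at hκ
  let c : Plane → ℂ := fun w => toComplex w / κ
  have hcn : ∀ w, ‖c w‖ = ‖w‖ := by
    intro w
    simp [c, hκ]
  have hc0 : ∀ w, c w = 0 ↔ w = 0 := fun w => by rw [← norm_eq_zero, hcn, norm_eq_zero]
  have hcs : ∀ w w', SameRay ℝ (c w) (c w') ↔ SameRay ℝ w w' := by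
    intro w w'
    have hinj : Function.Injective fun z : ℂ => z / κ := by
      intro z z' hz
      exact (div_left_inj' hκ0).1 hz
    let L : Plane →ₗ[ℝ] ℂ :=
      (LinearMap.mulRight ℝ κ⁻¹).comp (toComplex.toLinearEquiv : Plane →ₗ[ℝ] ℂ)
    have hL : ∀ w, L w = c w := fun w => by simp [L, c, div_eq_mul_inv]
    rw [← hL, ← hL]
    refine Function.Injective.sameRay_map_iff (f := L) ?_
    intro w w' hw
    rw [hL, hL] at hw
    exact toComplex.injective (hinj hw)
  have hcu : (c u).arg = Real.pi := by
    have : c u = ((-‖u‖ : ℝ) : ℂ) := by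
      simp only [c, κ]
      push_cast
      field_simp
    rw [this, arg_ofReal_of_neg (by simpa using hu)]
  have hcv : (c v).arg ≠ Real.pi := by
    intro hc
    exact huv ((hcs u v).1 (sameRay_iff.2 (.inr (.inr (hcu.trans hc.symm)))))
  have hP : ∀ w, ‖w‖ < ε → w ≠ 0 →
      (x + w ∈ P ↔ (c w).arg = Real.pi ∨ (c w).arg = (c v).arg) := by
    intro w hw hw0
    have h1 := hball (y := x + w) (by simpa using hw) (by simpa using hw0)
    rw [h1]
    simp only [mem_insert_iff, mem_singleton_iff, exists_eq_or_imp, exists_eq_left,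
      add_sub_cancel_left]
    rw [← hcs u w, ← hcs v w, sameRay_iff, sameRay_iff]
    simp only [hc0, hu, hv, hw0, false_or, hcu]
    rw [eq_comm, eq_comm (a := (c v).arg)]
  let d : ℂ → Plane := fun z => x + toComplex.symm (z * κ)
  have hd : Continuous d := by
    have := toComplex.symm.continuous
    fun_prop
  have hdc : ∀ w, d (c w) = x + w := by
    intro w
    simp [d, c, div_mul_cancel₀ _ hκ0]
  have hcd : ∀ z, c (toComplex.symm (z * κ)) = z := by
    intro z
    simp [c, mul_div_cancel_right₀ _ hκ0]
  have hyx : y - x ≠ 0 := by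
    rw [sub_ne_zero]
    rintro rfl
    exact hyP hx
  have hyε : ‖y - x‖ < ε := by simpa [dist_eq_norm] using hy
  have hyP' := hyP
  rw [← add_sub_cancel x y, hP _ hyε hyx, not_or] at hyP'
  obtain ⟨S, hS, hyS, hS1, hS2⟩ := exists_sector (ε := ε) (β := (c v).arg) (y := c (y - x))
    ⟨neg_pi_lt_arg _, lt_of_le_of_ne (arg_le_pi _) hcv⟩ (by rwa [ne_eq, hc0]) (by rwa [hcn])
    hyP'.1 hyP'.2
  refine ⟨d '' S, hS.image _ hd.continuousOn, ⟨_, hyS, by rw [hdc]; abel⟩, ?_, ?_⟩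
  · rintro _ ⟨z, hz, rfl⟩ hzP
    obtain ⟨h1, h2, h3, h4⟩ := hS1 z hz
    rw [← hcd z] at h1 h2 h3 h4
    rw [hcn] at h2
    rw [ne_eq, hc0] at h1
    rcases (hP _ h2 h1).1 hzP with h | h
    · exact h3 h
    · exact h4 h
  · intro z hz hzP hzx
    apply image_closure_subset_closure_image hd
    have hz0 : z - x ≠ 0 := sub_ne_zero.2 hzx
    have hzε : ‖z - x‖ < ε := by simpa [dist_eq_norm] using hz
    rw [← add_sub_cancel x z, hP _ hzε hz0] at hzP
    exact ⟨c (z - x), hS2 _ (by rwa [ne_eq, hc0]) (by rwa [hcn]) hzP, by rw [hdc]; abel⟩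

/-- Every component of the complement of a closed connected set that is everywhere locally
two different rays has the whole set in its boundary. -/
lemma subset_closure_connectedComponentIn {P : Set Plane} (hPc : IsClosed P)
    (hP : IsPreconnected P) (h : ∀ x ∈ P, IsTwoRayAt P x) {z : Plane} (hz : z ∉ P) :
    P ⊆ closure (connectedComponentIn Pᶜ z) := by
  set U := connectedComponentIn Pᶜ z with hU
  have hUo : IsOpen U := hPc.isOpen_compl.connectedComponentIn
  have hzU : z ∈ U := mem_connectedComponentIn hz
  have hUP : U ⊆ Pᶜ := connectedComponentIn_subset _ _
  rcases P.eq_empty_or_nonempty with rfl | ⟨p, hp⟩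
  · exact empty_subset _
  -- A component whose closure missed P would be clopen in the connected plane.
  have hne : (P ∩ closure U).Nonempty := by
    by_contra hcon
    have hcl : IsClosed U := by
      rw [← closure_subset_iff_isClosed]
      intro y hy
      have hyP : y ∉ P := fun hyP => hcon ⟨y, hyP, hy⟩
      obtain ⟨w, hw1, hw2⟩ := mem_closure_iff.1 hy _ (hPc.isOpen_compl.connectedComponentIn)
        (mem_connectedComponentIn (F := Pᶜ) hyP)
      rw [hU, connectedComponentIn_eq hw2, ← connectedComponentIn_eq hw1]
      exact mem_connectedComponentIn (F := Pᶜ) hyP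
    have := (IsClopen.eq_univ ⟨hcl, hUo⟩ ⟨z, hzU⟩).symm.subset (mem_univ p)
    exact hUP this hp
  choose! ε hε hS using fun x (hx : x ∈ P) => (h x hx).exists_isPreconnected hx
  -- P ∩ closure U is open in P: near x in it, U contains a whole local sector, whose closure
  -- contains P near x. Connectedness of P then finishes.
  let O : Set Plane := ⋃ x ∈ P ∩ closure U, Metric.ball x (ε x)
  have hO : IsOpen O := isOpen_biUnion fun _ _ => Metric.isOpen_ball
  have hPO : P ∩ O ⊆ closure U := by
    rintro y ⟨hyP, hyO⟩
    simp only [O, mem_iUnion] at hyO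
    obtain ⟨x, ⟨hxP, hxU⟩, hyx⟩ := hyO
    rcases eq_or_ne y x with rfl | hne
    · exact hxU
    obtain ⟨w, hw1, hw2⟩ := mem_closure_iff.1 hxU _ Metric.isOpen_ball
      (Metric.mem_ball_self (hε x hxP))
    obtain ⟨S, hSc, hwS, hSP, hcl⟩ := hS x hxP w hw1 (hUP hw2)
    refine closure_mono ?_ (hcl y hyx hyP hne)
    rw [hU, connectedComponentIn_eq hw2]
    exact hSc.subset_connectedComponentIn hwS hSP
  by_contra hcon
  obtain ⟨q, hqP, hqU⟩ := not_subset.1 hcon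
  have hself : P ∩ closure U ⊆ O := fun x hx =>
    mem_biUnion hx (Metric.mem_ball_self (hε x hx.1))
  obtain ⟨w, hw1, hw2, hw3⟩ := hP O (closure U)ᶜ hO isClosed_closure.isOpen_compl
    (fun x hx => by
      by_cases hxU : x ∈ closure U
      · exact .inl (hself ⟨hx, hxU⟩)
      · exact .inr hxU)
    (by obtain ⟨x, hx⟩ := hne; exact ⟨x, hx.1, hself hx⟩) ⟨q, hqP, hqU⟩
  exact hw3 (hPO ⟨hw1, hw2⟩)

end Boundary

/-! ### Topology and local shape of polygonal arcs. -/

section Arcs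

lemma isCompact_biUnion_segment (p : ℕ → Plane) {T : Set ℕ} (hT : T.Finite) :
    IsCompact (⋃ i ∈ T, segment ℝ (p i) (p (i + 1))) :=
  hT.isCompact_biUnion fun i _ => by
    rw [segment_eq_image_lineMap]
    exact isCompact_Icc.image AffineMap.lineMap_continuous

lemma isClosed_biUnion_segment (p : ℕ → Plane) {T : Set ℕ} (hT : T.Finite) :
    IsClosed (⋃ i ∈ T, segment ℝ (p i) (p (i + 1))) :=
  (isCompact_biUnion_segment p hT).isClosed

lemma isPreconnected_segment_diff_right (a b : Plane) : IsPreconnected (segment ℝ a b \ {b}) := by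
  rcases eq_or_ne a b with rfl | hab
  · simp [isPreconnected_empty]
  have : segment ℝ a b \ {b} = AffineMap.lineMap a b '' Ico (0 : ℝ) 1 := by
    rw [segment_eq_image_lineMap, ← Icc_sdiff_right,
      image_sdiff (AffineMap.lineMap_injective ℝ hab), image_singleton,
      AffineMap.lineMap_apply_one]
  rw [this]
  exact isPreconnected_Ico.image _ AffineMap.lineMap_continuous.continuousOn

lemma isPreconnected_biUnion_segment (p : ℕ → Plane) (k : ℕ) :
    IsPreconnected (⋃ i ∈ Iio k, segment ℝ (p i) (p (i + 1))) := by
  induction k with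
  | zero => simp [isPreconnected_empty]
  | succ k ih =>
    have hs : IsPreconnected (segment ℝ (p k) (p (k + 1))) := (convex_segment _ _).isPreconnected
    have heq : Iio (k + 1) = insert k (Iio k) := by ext; simp
    rw [heq, biUnion_insert]
    rcases k with _ | k
    · simpa using hs
    · refine IsPreconnected.union (p (k + 1)) (left_mem_segment ℝ _ _) ?_ hs ih
      exact mem_biUnion (mem_Iio.2 k.lt_succ_self) (right_mem_segment ℝ _ _)

lemma biUnion_segment_eq (p : ℕ → Plane) {m : ℕ} {T : Set ℕ} (hT : T ⊆ Iio m) :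
    ⋃ i ∈ Iio m, segment ℝ (p i) (p (i + 1)) =
      (⋃ i ∈ T, segment ℝ (p i) (p (i + 1))) ∪
        ⋃ i ∈ Iio m \ T, segment ℝ (p i) (p (i + 1)) := by
  rw [← biUnion_union, union_sdiff_cancel hT]

variable {a b : Plane} {A : Set Plane}

lemma IsPolygonalArc.isCompact (h : IsPolygonalArc a b A) : IsCompact A := by
  obtain ⟨m, p, -, -, -, -, -, rfl⟩ := h
  exact isCompact_biUnion_segment p (finite_Iio m)

lemma IsPolygonalArc.isPreconnected (h : IsPolygonalArc a b A) : IsPreconnected A := by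
  obtain ⟨m, p, -, -, -, -, -, rfl⟩ := h
  exact isPreconnected_biUnion_segment p m

lemma IsPolygonalArc.left_mem (h : IsPolygonalArc a b A) : a ∈ A := by
  obtain ⟨m, p, hm, rfl, -, -, -, rfl⟩ := h
  exact mem_biUnion (mem_Iio.2 hm) (left_mem_segment ℝ _ _)

lemma IsPolygonalArc.right_mem (h : IsPolygonalArc a b A) : b ∈ A := by
  obtain ⟨m, p, hm, -, rfl, -, -, rfl⟩ := h
  obtain ⟨m, rfl⟩ : ∃ k, m = k + 1 := ⟨m - 1, by omega⟩
  exact mem_biUnion (mem_Iio.2 m.lt_succ_self) (right_mem_segment ℝ _ _)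

/-- Needed for an edge that runs up to a cycle and touches it only at its last point. -/
lemma IsPolygonalArc.isPreconnected_diff_right (h : IsPolygonalArc a b A) :
    IsPreconnected (A \ {b}) := by
  obtain ⟨m, p, hm, -, rfl, hinj, hseg, rfl⟩ := h
  obtain ⟨m, rfl⟩ : ∃ k, m = k + 1 := ⟨m - 1, by omega⟩
  have hs := isPreconnected_segment_diff_right (p m) (p (m + 1))
  have hne : p m ≠ p (m + 1) := fun h => by
    have := hinj (show m ∈ Iic (m + 1) by simp) (show m + 1 ∈ Iic (m + 1) by simp) h
    omega
  have heq : Iio (m + 1) = insert m (Iio m) := by ext; simp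
  have hb : p (m + 1) ∉ ⋃ i ∈ Iio m, segment ℝ (p i) (p (i + 1)) := by
    simp only [mem_iUnion, not_exists, mem_Iio]
    intro i hi hmem
    have := hseg i (by omega) m (by omega) hi ⟨hmem, right_mem_segment ℝ _ _⟩
    exact hne this.2.symm
  rw [heq, biUnion_insert, union_sdiff_distrib, sdiff_singleton_eq_self hb]
  rcases m with _ | m
  · simpa using hs
  · refine IsPreconnected.union (p (m + 1)) ⟨left_mem_segment ℝ _ _, hne⟩ ?_ hs
      (isPreconnected_biUnion_segment p (m + 1))
    exact mem_biUnion (mem_Iio.2 m.lt_succ_self) (right_mem_segment ℝ _ _)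

lemma IsPolygonalArc.ne (h : IsPolygonalArc a b A) : a ≠ b := by
  obtain ⟨m, p, hm, rfl, rfl, hinj, -, -⟩ := h
  intro h
  have := hinj (show 0 ∈ Iic m by simp) (show m ∈ Iic m by simp) h
  omega

/-- Only the first segment contains a; the others form a closed set that misses it. The left end
suffices, since a drawing supplies each edge in both orientations. -/
lemma IsPolygonalArc.hasStarAt_left (h : IsPolygonalArc a b A) :
    ∃ u, u ≠ 0 ∧ HasStarAt A a {u} := by
  obtain ⟨m, p, hm, rfl, rfl, hinj, hseg, rfl⟩ := h
  have hne : p 0 ≠ p 1 := fun h => by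
    have := hinj (show 0 ∈ Iic m by simp) (show 1 ∈ Iic m by simpa using hm) h
    omega
  refine ⟨p 1 - p 0, sub_ne_zero.2 hne.symm, ?_⟩
  rw [biUnion_segment_eq p (m := m) (T := {0}) (by simpa using by omega), biUnion_singleton]
  refine (hasStarAt_segment_left hne).union_isClosed
    (isClosed_biUnion_segment p ((finite_Iio m).sdiff)) ?_
  simp only [mem_iUnion, not_exists, Set.mem_sdiff, mem_Iio, mem_singleton_iff]
  rintro i ⟨hi, hi0⟩ hmem
  obtain ⟨h1, h2⟩ := hseg 0 (by omega) i hi (by omega) ⟨left_mem_segment ℝ _ _, hmem⟩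
  have := hinj (show 0 ∈ Iic m by simp) (show i ∈ Iic m from hi.le) h2
  omega

lemma IsPolygonalArc.isTwoRayAt (h : IsPolygonalArc a b A) {x : Plane} (hx : x ∈ A)
    (hxa : x ≠ a) (hxb : x ≠ b) : IsTwoRayAt A x := by
  obtain ⟨m, p, hm, rfl, rfl, hinj, hseg, rfl⟩ := h
  have hne : ∀ i < m, p i ≠ p (i + 1) := fun i hi h => by
    have := hinj (show i ∈ Iic m from hi.le) (show i + 1 ∈ Iic m from hi) h
    omega
  have corner : ∀ j, j + 1 < m → x = p (j + 1) →
      IsTwoRayAt (⋃ i ∈ Iio m, segment ℝ (p i) (p (i + 1))) x := by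
    rintro j hj rfl
    rw [biUnion_segment_eq p (m := m) (T := {j, j + 1})
      (by rintro i (rfl | rfl) <;> simp <;> omega), biUnion_pair]
    refine IsTwoRayAt.union_isClosed ?_ (isClosed_biUnion_segment p ((finite_Iio m).sdiff)) ?_
    · exact (hasStarAt_segment_right (hne j (by omega))).isTwoRayAt_union
        (hasStarAt_segment_left (hne (j + 1) hj)) (sub_ne_zero.2 (hne j (by omega)))
        (sub_ne_zero.2 (hne (j + 1) hj).symm)
        (fun y hy => (hseg j (by omega) (j + 1) hj (by omega) hy).2)
    · simp only [mem_iUnion, not_exists, Set.mem_sdiff, mem_Iio, mem_singleton_iff, mem_insert_iff,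
        not_or]
      rintro i ⟨hi, hi0, hi1⟩ hmem
      rcases lt_or_gt_of_ne hi1 with h | h
      · have := (hseg i hi (j + 1) hj h ⟨hmem, left_mem_segment ℝ _ _⟩).1
        omega
      · obtain ⟨h1, h2⟩ := hseg (j + 1) hj i hi h ⟨left_mem_segment ℝ _ _, hmem⟩
        subst h1
        exact hne _ hj h2
  have hx' := hx
  simp only [mem_iUnion, mem_Iio] at hx'
  obtain ⟨k, hk, hxk⟩ := hx'
  by_cases h1 : x = p k
  · rcases k with _ | k
    · exact absurd h1 hxa
    · exact corner k hk h1
  by_cases h2 : x = p (k + 1)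
  · refine corner k (lt_of_le_of_ne hk ?_) h2
    rintro rfl
    exact hxb h2
  rw [biUnion_segment_eq p (m := m) (T := {k}) (by simpa using hk), biUnion_singleton]
  refine (isTwoRayAt_segment hxk h1 h2).union_isClosed
    (isClosed_biUnion_segment p ((finite_Iio m).sdiff)) ?_
  simp only [mem_iUnion, not_exists, Set.mem_sdiff, mem_Iio, mem_singleton_iff]
  rintro i ⟨hi, hik⟩ hmem
  rcases lt_or_gt_of_ne hik with h | h
  · exact h1 (hseg i hi k hk h ⟨hmem, hxk⟩).2
  · obtain ⟨h3, h4⟩ := hseg k hk i hi h ⟨hxk, hmem⟩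
    subst h3
    exact h2 h4

end Arcs

/-! ### Viewing angles and their jump across a segment. -/

section Winding
open Complex

/-- The angle under which the segment from `p` to `q` is seen from `x`. -/
noncomputable def segAngle (p q x : Plane) : ℝ :=
  ((toComplex q - toComplex x) / (toComplex p - toComplex x)).arg

/-- A ratio -s with s ≥ 0 says q - x = -s(p - x), so x is the convex combination of p and q with
weights s/(1+s) and 1/(1+s). -/
lemma ratio_mem_slitPlane {p q x : Plane} (hx : x ∉ segment ℝ p q) :
    (toComplex q - toComplex x) / (toComplex p - toComplex x) ∈ slitPlane := by
  by_contra hcon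
  rw [mem_slitPlane_iff, not_or, not_lt, not_not] at hcon
  have hp : toComplex p - toComplex x ≠ 0 := by
    rw [sub_ne_zero]
    intro h
    exact hx (toComplex.injective h ▸ left_mem_segment ℝ _ _)
  obtain ⟨s, hs, hs'⟩ : ∃ s : ℝ, 0 ≤ s ∧
      (toComplex q - toComplex x) / (toComplex p - toComplex x) = -(s : ℂ) :=
    ⟨-_, neg_nonneg.2 hcon.1, Complex.ext (by simp) (by simpa using hcon.2)⟩
  rw [div_eq_iff hp] at hs'
  have h1 : (0 : ℝ) < 1 + s := by linarith
  apply hx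
  refine ⟨s / (1 + s), 1 / (1 + s), by positivity, by positivity, by field_simp; ring, ?_⟩
  apply toComplex.injective
  rw [map_add, map_smul, map_smul]
  simp only [real_smul]
  have h2 : (1 + s : ℂ) ≠ 0 := by exact_mod_cast h1.ne'
  push_cast
  field_simp
  linear_combination hs'

lemma continuousAt_segAngle {p q x : Plane} (hx : x ∉ segment ℝ p q) :
    ContinuousAt (segAngle p q) x := by
  have hp : toComplex p - toComplex x ≠ 0 := by
    rw [sub_ne_zero]
    intro h
    exact hx (toComplex.injective h ▸ left_mem_segment ℝ _ _)
  refine (continuousAt_arg (ratio_mem_slitPlane hx)).comp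
    (f := fun x => (toComplex q - toComplex x) / (toComplex p - toComplex x)) ?_
  have := toComplex.continuous
  exact ContinuousAt.div (by fun_prop) (by fun_prop) hp

lemma norm_mul_exp_segAngle (p q x : Plane) (hx : x ∉ segment ℝ p q) :
    ∃ r : ℝ, 0 ≤ r ∧ r * exp (segAngle p q x * I) * (toComplex p - toComplex x) =
      toComplex q - toComplex x := by
  have hp : toComplex p - toComplex x ≠ 0 := by
    rw [sub_ne_zero]
    intro h
    exact hx (toComplex.injective h ▸ left_mem_segment ℝ _ _)
  refine ⟨‖(toComplex q - toComplex x) / (toComplex p - toComplex x)‖, norm_nonneg _, ?_⟩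
  rw [segAngle, norm_mul_exp_arg_mul_I, div_mul_cancel₀ _ hp]

lemma tendsto_segAngle_cocompact (p q : Plane) :
    Tendsto (segAngle p q) (cocompact Plane) (𝓝 0) := by
  have h1 : Tendsto (fun x => toComplex p - toComplex x) (cocompact Plane) (cocompact ℂ) := by
    exact ((Homeomorph.subLeft (toComplex p)).isClosedEmbedding.tendsto_cocompact).comp
      (toComplex.toIsometryEquiv.toHomeomorph.isClosedEmbedding.tendsto_cocompact)
  have h2 : Tendsto (fun x => (toComplex p - toComplex x)⁻¹) (cocompact Plane) (𝓝 0) := by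
    rw [← Metric.cobounded_eq_cocompact (α := ℂ)] at h1
    exact tendsto_inv₀_cobounded.comp h1
  have h3 : Tendsto (fun x => 1 + (toComplex q - toComplex p) * (toComplex p - toComplex x)⁻¹)
      (cocompact Plane) (𝓝 1) := by
    simpa using (h2.const_mul (toComplex q - toComplex p)).const_add 1
  have h4 : Tendsto (fun x => (toComplex q - toComplex x) / (toComplex p - toComplex x))
      (cocompact Plane) (𝓝 1) := by
    refine h3.congr' ?_
    have : ∀ᶠ x in cocompact Plane, x ∈ ({p} : Set Plane)ᶜ :=
      isCompact_singleton.compl_mem_cocompact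
    filter_upwards [this] with x hx
    have : toComplex p - toComplex x ≠ 0 := by
      rw [sub_ne_zero]
      intro h
      exact hx (toComplex.injective h).symm
    field_simp
    ring
  have := (continuousAt_arg one_mem_slitPlane).tendsto.comp h4
  rw [arg_one] at this
  exact this

/-- The viewing angle of a segment jumps by `2π` when the segment is crossed in its middle. -/
lemma exists_segAngle_jump {p q : Plane} (hpq : p ≠ q) :
    ∃ x ∈ segment ℝ p q, x ≠ p ∧ x ≠ q ∧ ∃ n : Plane,
      Tendsto (fun t : ℝ => segAngle p q (x + t • n) - segAngle p q (x - t • n)) (𝓝[>] 0)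
        (𝓝 (2 * Real.pi)) ∧
      ∀ᶠ t in 𝓝[>] (0 : ℝ), x + t • n ∉ segment ℝ p q ∧ x - t • n ∉ segment ℝ p q := by
  set δ : ℂ := (toComplex q - toComplex p) / 2 with hδ
  have hδ0 : δ ≠ 0 := by
    refine div_ne_zero (sub_ne_zero.2 fun h => hpq (toComplex.injective h).symm) two_ne_zero
  have hx : toComplex (midpoint ℝ p q) = toComplex p + δ := by
    rw [midpoint_eq_smul_add, map_smul, map_add, hδ, real_smul, invOf_eq_inv]
    push_cast
    ring
  -- This is -(1 - tI)/(1 + tI), the ratio seen from the midpoint displaced by t times the normal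
  -- Iδ. It equals -1 at t = 0 and its imaginary part has the sign of t, so its argument jumps from
  -- -π to π.
  let R : ℝ → ℂ := fun t => (-(1 - t ^ 2) + 2 * t * I) / (1 + t ^ 2)
  have hden : ∀ t : ℝ, (1 + t ^ 2 : ℂ) ≠ 0 := by
    intro t
    have : (1 + t ^ 2 : ℝ) ≠ 0 := by positivity
    exact_mod_cast this
  have hRre : ∀ t : ℝ, R t = ((-(1 - t ^ 2) / (1 + t ^ 2) : ℝ) : ℂ) +
      ((2 * t / (1 + t ^ 2) : ℝ) : ℂ) * I := by
    intro t
    simp only [R]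
    push_cast
    ring
  have hRim : ∀ t : ℝ, (R t).im = 2 * t / (1 + t ^ 2) := by
    intro t
    rw [hRre]
    simp only [add_im, ofReal_im, im_ofReal_mul, I_im, mul_one, zero_add]
  have hR : ∀ t : ℝ, segAngle p q (midpoint ℝ p q + t • toComplex.symm (I * δ)) = (R t).arg := by
    intro t
    have h2 : toComplex q = toComplex p + 2 * δ := by rw [hδ]; ring
    have h3 : toComplex p - (toComplex p + δ + t * (I * δ)) ≠ 0 := by
      have h4 : (1 + t * I : ℂ) ≠ 0 := by
        intro h
        simpa using congrArg re h
      have : toComplex p - (toComplex p + δ + t * (I * δ)) = -(δ * (1 + t * I)) := by ring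
      rw [this]
      exact neg_ne_zero.2 (mul_ne_zero hδ0 h4)
    rw [segAngle, map_add, map_smul, hx, LinearIsometryEquiv.apply_symm_apply, h2, real_smul]
    congr 1
    rw [div_eq_div_iff h3 (hden t)]
    linear_combination 2 * t ^ 2 * δ * I_sq
  have hRc : Continuous R := Continuous.div (by fun_prop) (by fun_prop) hden
  have hR0 : R 0 = -1 := by simp [R]
  have hpos : Tendsto (fun t => (R t).arg) (𝓝[>] 0) (𝓝 Real.pi) := by
    have := tendsto_arg_nhdsWithin_im_nonneg_of_re_neg_of_im_zero (z := -1) (by simp) (by simp)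
    refine this.comp (tendsto_nhdsWithin_of_tendsto_nhds_of_eventually_within _ ?_ ?_)
    · exact hR0 ▸ (hRc.tendsto 0).mono_left nhdsWithin_le_nhds
    · filter_upwards [self_mem_nhdsWithin] with t ht
      have := mem_Ioi.1 ht
      change 0 ≤ (R t).im
      rw [hRim]
      positivity
  have hneg : Tendsto (fun t => (R (-t)).arg) (𝓝[>] 0) (𝓝 (-Real.pi)) := by
    have := tendsto_arg_nhdsWithin_im_neg_of_re_neg_of_im_zero (z := -1) (by simp) (by simp)
    refine this.comp (tendsto_nhdsWithin_of_tendsto_nhds_of_eventually_within _ ?_ ?_)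
    · have h := (hRc.comp continuous_neg).tendsto 0
      simp only [Function.comp_apply, neg_zero, hR0] at h
      exact h.mono_left nhdsWithin_le_nhds
    · filter_upwards [self_mem_nhdsWithin] with t ht
      have := mem_Ioi.1 ht
      change (R (-t)).im < 0
      rw [hRim, mul_neg, neg_div, neg_lt_zero]
      positivity
  have hoff : ∀ t : ℝ, t ≠ 0 →
      midpoint ℝ p q + t • toComplex.symm (I * δ) ∉ segment ℝ p q := by
    intro t ht hmem
    rw [segment_eq_image'] at hmem
    obtain ⟨s, -, hs⟩ := hmem
    have h := congrArg toComplex hs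
    simp only [map_add, map_smul, hx, LinearIsometryEquiv.apply_symm_apply, real_smul,
      map_sub] at h
    have h2 : δ * (2 * s - 1 - t * I) = 0 := by
      linear_combination h + 2 * s * hδ
    have h3 := congrArg im ((mul_eq_zero.1 h2).resolve_left hδ0)
    simp at h3
    exact ht h3
  refine ⟨midpoint ℝ p q, midpoint_mem_segment p q, by simpa using hpq,
    by simpa using hpq, toComplex.symm (I * δ), ?_, ?_⟩
  · have := hpos.sub hneg
    rw [sub_neg_eq_add, ← two_mul] at this
    refine this.congr fun t => ?_
    rw [hR, sub_eq_add_neg (midpoint ℝ p q), ← neg_smul, hR]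
  · filter_upwards [self_mem_nhdsWithin] with t ht
    refine ⟨hoff t (ne_of_gt ht), ?_⟩
    rw [sub_eq_add_neg, ← neg_smul]
    exact hoff _ (neg_ne_zero.2 (ne_of_gt ht))

/-- A continuous choice of the angle under which a polygonal arc is seen. -/
lemma IsPolygonalArc.exists_angle {a b : Plane} {A : Set Plane} (h : IsPolygonalArc a b A) :
    ∃ θ : Plane → ℝ, (∀ x ∉ A, ContinuousAt θ x) ∧
      (∀ x ∉ A, ∃ r : ℝ, 0 ≤ r ∧ r * exp (θ x * I) * (toComplex a - toComplex x) =
        toComplex b - toComplex x) ∧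
      Tendsto θ (cocompact Plane) (𝓝 0) ∧
      ∃ x ∈ A, x ≠ a ∧ x ≠ b ∧ ∃ n : Plane,
        Tendsto (fun t : ℝ => θ (x + t • n) - θ (x - t • n)) (𝓝[>] 0) (𝓝 (2 * Real.pi)) ∧
        ∀ᶠ t in 𝓝[>] (0 : ℝ), x + t • n ∉ A ∧ x - t • n ∉ A := by
  obtain ⟨m, p, hm, rfl, rfl, hinj, hseg, rfl⟩ := h
  have hmem : ∀ {x}, x ∉ ⋃ i ∈ Iio m, segment ℝ (p i) (p (i + 1)) → ∀ i < m,
      x ∉ segment ℝ (p i) (p (i + 1)) := fun hx i hi h => hx (mem_biUnion (mem_Iio.2 hi) h)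
  have hne : p 0 ≠ p 1 := fun h => by
    have := hinj (show 0 ∈ Iic m by simp) (show 1 ∈ Iic m by simpa using hm) h
    omega
  refine ⟨fun x => ∑ i ∈ Finset.range m, segAngle (p i) (p (i + 1)) x, ?_, ?_, ?_, ?_⟩
  · intro x hx
    exact tendsto_finsetSum _ fun i hi =>
      continuousAt_segAngle (hmem hx i (Finset.mem_range.1 hi))
  · intro x hx
    suffices H : ∀ k ≤ m, ∃ r : ℝ, 0 ≤ r ∧
        r * exp ((∑ i ∈ Finset.range k, segAngle (p i) (p (i + 1)) x : ℝ) * I) *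
          (toComplex (p 0) - toComplex x) = toComplex (p k) - toComplex x from H m le_rfl
    intro k
    induction k with
    | zero => exact fun _ => ⟨1, zero_le_one, by simp⟩
    | succ k ih =>
      intro hk
      obtain ⟨r, hr, h1⟩ := ih (by omega)
      obtain ⟨r', hr', h2⟩ := norm_mul_exp_segAngle (p k) (p (k + 1)) x (hmem hx k (by omega))
      refine ⟨r' * r, mul_nonneg hr' hr, ?_⟩
      rw [← h2, ← h1, Finset.sum_range_succ]
      push_cast
      rw [add_mul, exp_add]
      ring
  · simpa using tendsto_finsetSum (Finset.range m) fun i _ =>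
      tendsto_segAngle_cocompact (p i) (p (i + 1))
  · obtain ⟨x, hx, hxp, hxq, n, hjump, hoff⟩ := exists_segAngle_jump hne
    obtain ⟨m, rfl⟩ : ∃ k, m = k + 1 := ⟨m - 1, by omega⟩
    -- The chosen point of the first segment is on no other segment, so only the first summand jumps
    -- there.
    have hrest : ∀ i, i ≠ 0 → i < m + 1 → x ∉ segment ℝ (p i) (p (i + 1)) := by
      intro i hi0 hi hxi
      obtain ⟨h1, h2⟩ := hseg 0 (by omega) i hi (by omega) ⟨hx, hxi⟩
      subst h1
      exact hxq h2
    have hplus : Tendsto (fun t : ℝ => x + t • n) (𝓝[>] 0) (𝓝 x) := by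
      have : Continuous fun t : ℝ => x + t • n := by fun_prop
      simpa using (this.tendsto 0).mono_left nhdsWithin_le_nhds
    have hminus : Tendsto (fun t : ℝ => x - t • n) (𝓝[>] 0) (𝓝 x) := by
      have : Continuous fun t : ℝ => x - t • n := by fun_prop
      simpa using (this.tendsto 0).mono_left nhdsWithin_le_nhds
    have hx0 : x ≠ p (m + 1) := by
      rintro rfl
      rcases m with _ | m
      · exact hxq rfl
      · exact hrest (m + 1) (by omega) (by omega) (right_mem_segment ℝ _ _)
    refine ⟨x, mem_biUnion (mem_Iio.2 m.succ_pos) hx, hxp, hx0, n, ?_, ?_⟩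
    · have hc : ContinuousAt
          (fun x => ∑ i ∈ Finset.range m, segAngle (p (i + 1)) (p (i + 1 + 1)) x) x :=
        tendsto_finsetSum _ fun i hi => continuousAt_segAngle
          (hrest (i + 1) (by omega) (by have := Finset.mem_range.1 hi; omega))
      have := ((hc.tendsto.comp hplus).sub (hc.tendsto.comp hminus)).add hjump
      rw [sub_self, zero_add] at this
      refine this.congr fun t => ?_
      simp only [Finset.sum_range_succ', Function.comp_apply]
      ring
    · have hcl : IsClosed (⋃ i ∈ Iio (m + 1) \ {0}, segment ℝ (p i) (p (i + 1))) :=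
        isClosed_biUnion_segment p ((finite_Iio _).sdiff)
      have hxc : x ∈ (⋃ i ∈ Iio (m + 1) \ {0}, segment ℝ (p i) (p (i + 1)))ᶜ := by
        simp only [mem_compl_iff, mem_iUnion, not_exists, Set.mem_sdiff, mem_Iio, mem_singleton_iff]
        exact fun i hi => hrest i hi.2 hi.1
      have hev := hcl.isOpen_compl.mem_nhds hxc
      rw [biUnion_segment_eq p (m := m + 1) (T := {0}) (by simp), biUnion_singleton]
      filter_upwards [hoff, hplus.eventually_mem hev, hminus.eventually_mem hev]
        with t h1 h2 h3
      exact ⟨fun h => h.elim h1.1 h2, fun h => h.elim h1.2 h3⟩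

end Winding

/-! ### The curve of a cycle and the components of its complement. -/

section Drawings

variable {V : Type*} {G : SimpleGraph V} (D : PlaneDrawing G) (K : Cycle G)

lemma Cycle.edges_subset {e : Sym2 V} (he : e ∈ K.walk.edges) : e ∈ G.edgeSet :=
  K.walk.edges_subset_edgeSet he

/-- A vertex of a cycle lies on exactly two of its edges. -/
lemma Cycle.exists_two_edges {v : V} (hv : v ∈ K.verts) :
    ∃ w w', w ≠ w' ∧ s(v, w) ∈ K.walk.edges ∧ s(v, w') ∈ K.walk.edges ∧
      ∀ e ∈ K.walk.edges, v ∈ e → e = s(v, w) ∨ e = s(v, w') := by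
  obtain ⟨w, w', hne, h⟩ := ncard_eq_two.1 (K.isCycle.ncard_neighborSet_toSubgraph_eq_two hv)
  have key : ∀ z, s(v, z) ∈ K.walk.edges ↔ z = w ∨ z = w' := by
    intro z
    rw [← SimpleGraph.Walk.adj_toSubgraph_iff_mem_edges, ← SimpleGraph.Subgraph.mem_neighborSet,
      h, mem_insert_iff, mem_singleton_iff]
  refine ⟨w, w', hne, (key w).2 (.inl rfl), (key w').2 (.inr rfl), ?_⟩
  rintro e he hve
  obtain ⟨z, rfl⟩ := Sym2.mem_iff_exists.1 hve
  exact ((key z).1 he).imp (congrArg _) (congrArg _)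

lemma Cycle.mem_verts_of_mem_edge {e : Sym2 V} (he : e ∈ K.walk.edges) {v : V} (hv : v ∈ e) :
    v ∈ K.verts := by
  obtain ⟨z, rfl⟩ := Sym2.mem_iff_exists.1 hv
  exact K.walk.fst_mem_support_of_mem_edges he

namespace PlaneDrawing

lemma isPolygonalArc {u v : V} (h : s(u, v) ∈ G.edgeSet) :
    IsPolygonalArc (D.point u) (D.point v) (D.arc s(u, v)) := D.isPolygonalArc_arc u v h

lemma isCompact_arc {e : Sym2 V} (he : e ∈ G.edgeSet) : IsCompact (D.arc e) := by
  induction e with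
  | _ u v => exact (D.isPolygonalArc he).isCompact

lemma point_mem_arc {e : Sym2 V} (he : e ∈ G.edgeSet) {v : V} (hv : v ∈ e) :
    D.point v ∈ D.arc e := by
  obtain ⟨z, rfl⟩ := Sym2.mem_iff_exists.1 hv
  exact (D.isPolygonalArc he).left_mem

lemma isCompact_curve : IsCompact (D.curve K) :=
  (List.finite_toSet K.walk.edges).isCompact_biUnion fun _ he =>
    D.isCompact_arc (K.edges_subset he)

variable {K} in
lemma arc_subset_curve {e : Sym2 V} (he : e ∈ K.walk.edges) : D.arc e ⊆ D.curve K :=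
  subset_biUnion_of_mem (u := D.arc) he

lemma point_mem_curve_iff {v : V} : D.point v ∈ D.curve K ↔ v ∈ K.verts := by
  constructor
  · intro h
    obtain ⟨e, he, hv⟩ := mem_iUnion₂.1 h
    exact K.mem_verts_of_mem_edge he (D.mem_of_point_mem_arc e (K.edges_subset he) v hv)
  · intro h
    obtain ⟨w, -, -, hw, -⟩ := K.exists_two_edges h
    exact D.arc_subset_curve hw (D.point_mem_arc (K.edges_subset hw) (Sym2.mem_mk_left v w))

lemma isPreconnected_walk {u v : V} (w : G.Walk u v) :
    IsPreconnected ({D.point u} ∪ ⋃ e ∈ {e | e ∈ w.edges}, D.arc e) := by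
  induction w with
  | nil => simp [isPreconnected_singleton]
  | @cons a b c h w ih =>
    have harc := D.isPolygonalArc_arc a b h
    have heq : {D.point a} ∪ ⋃ e ∈ {e | e ∈ (SimpleGraph.Walk.cons h w).edges}, D.arc e =
        D.arc s(a, b) ∪ ({D.point b} ∪ ⋃ e ∈ {e | e ∈ w.edges}, D.arc e) := by
      have h1 : {e | e ∈ (SimpleGraph.Walk.cons h w).edges} =
          insert s(a, b) {e | e ∈ w.edges} := by
        ext e
        simp
      rw [h1, biUnion_insert, ← union_assoc, ← union_assoc,
        union_eq_self_of_subset_left (singleton_subset_iff.2 harc.left_mem),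
        union_eq_self_of_subset_right (singleton_subset_iff.2 harc.right_mem)]
    rw [heq]
    exact harc.isPreconnected.union (D.point b) harc.right_mem (.inl rfl) ih

lemma isPreconnected_curve : IsPreconnected (D.curve K) := by
  have h := D.isPreconnected_walk K.walk
  rwa [union_eq_self_of_subset_left] at h
  exact singleton_subset_iff.2 ((D.point_mem_curve_iff K).2 K.walk.start_mem_support)

lemma isTwoRayAt_curve {x : Plane} (hx : x ∈ D.curve K) : IsTwoRayAt (D.curve K) x := by
  -- The edges that miss x form a closed set, so only those through x matter: two at a vertex, one
  -- elsewhere.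
  have split : ∀ T : Set (Sym2 V), T ⊆ {e | e ∈ K.walk.edges} →
      (∀ e ∈ K.walk.edges, x ∈ D.arc e → e ∈ T) → IsTwoRayAt (⋃ e ∈ T, D.arc e) x →
      IsTwoRayAt (D.curve K) x := by
    intro T hT hxT h
    have heq : D.curve K =
        (⋃ e ∈ T, D.arc e) ∪ ⋃ e ∈ {e | e ∈ K.walk.edges} \ T, D.arc e := by
      rw [← biUnion_union, union_sdiff_cancel hT]
      rfl
    rw [heq]
    refine h.union_isClosed ?_ ?_
    · exact ((List.finite_toSet K.walk.edges).sdiff).isClosed_biUnion fun e he =>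
        (D.isCompact_arc (K.edges_subset he.1)).isClosed
    · simp only [mem_iUnion, not_exists]
      exact fun e he hxe => he.2 (hxT e he.1 hxe)
  by_cases hv : ∃ v, D.point v = x
  · obtain ⟨v, rfl⟩ := hv
    obtain ⟨w, w', hne, hw, hw', hall⟩ :=
      K.exists_two_edges ((D.point_mem_curve_iff K).1 hx)
    have he := K.edges_subset hw
    have he' := K.edges_subset hw'
    refine split {s(v, w), s(v, w')} ?_ ?_ ?_
    · rintro e (rfl | rfl)
      exacts [hw, hw']
    · intro e heK hve
      exact hall e heK (D.mem_of_point_mem_arc e (K.edges_subset heK) v hve)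
    · rw [biUnion_pair]
      obtain ⟨f, hf, hs⟩ := (D.isPolygonalArc he).hasStarAt_left
      obtain ⟨f', hf', hs'⟩ := (D.isPolygonalArc he').hasStarAt_left
      refine hs.isTwoRayAt_union hs' hf hf' ?_
      refine (D.arc_inter_arc _ he _ he' fun h => hne (Sym2.congr_right.1 h)).trans ?_
      rintro _ ⟨z, ⟨h1, h2⟩, rfl⟩
      rw [Sym2.mem_iff] at h1 h2
      rcases h1 with rfl | rfl
      · rfl
      · rcases h2 with rfl | rfl
        · rfl
        · exact absurd rfl hne
  · obtain ⟨e, he, hxe⟩ := mem_iUnion₂.1 hx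
    refine split {e} (singleton_subset_iff.2 he) ?_ ?_
    · intro e' he' hxe'
      by_contra hne
      obtain ⟨z, -, hz⟩ := D.arc_inter_arc e (K.edges_subset he) e' (K.edges_subset he')
        (Ne.symm hne) ⟨hxe, hxe'⟩
      exact hv ⟨z, hz⟩
    · rw [biUnion_singleton]
      induction e with
      | _ a b =>
        exact (D.isPolygonalArc (K.edges_subset he)).isTwoRayAt hxe
          (fun h => hv ⟨a, h.symm⟩) (fun h => hv ⟨b, h.symm⟩)

/-- Every component of the complement of a cycle has the whole cycle in its boundary. -/
lemma curve_subset_closure {z : Plane} (hz : z ∉ D.curve K) :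
    D.curve K ⊆ closure (connectedComponentIn (D.curve K)ᶜ z) :=
  subset_closure_connectedComponentIn (D.isCompact_curve K).isClosed (D.isPreconnected_curve K)
    (fun _ => D.isTwoRayAt_curve K) hz

lemma exists_unbounded : ∃ z ∉ D.curve K,
    ¬ Bornology.IsBounded (connectedComponentIn (D.curve K)ᶜ z) := by
  obtain ⟨R, hR⟩ := (D.isCompact_curve K).isBounded.subset_ball 0
  set S : Set Plane := toComplex.symm '' {z : ℂ | R ≤ z.re} with hS
  have hSc : IsPreconnected S := ((convex_halfSpace_re_ge R).isPreconnected).image _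
    toComplex.symm.continuous.continuousOn
  have hSK : S ⊆ (D.curve K)ᶜ := by
    rintro _ ⟨z, hz, rfl⟩ hzK
    have h1 := hR hzK
    rw [mem_ball_zero_iff, LinearIsometryEquiv.norm_map] at h1
    have h2 := (Complex.re_le_norm z).trans_lt h1
    have h3 : R ≤ z.re := hz
    exact absurd h3 (not_le.2 h2)
  have hR0 : toComplex.symm (R : ℂ) ∈ S := ⟨R, by simp, rfl⟩
  refine ⟨_, hSK hR0, fun hb => ?_⟩
  obtain ⟨M, hM⟩ := (hb.subset (hSc.subset_connectedComponentIn hR0 hSK)).exists_norm_le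
  have := hM (toComplex.symm ((max R (M + 1) : ℝ) : ℂ)) ⟨_, by simp, rfl⟩
  rw [LinearIsometryEquiv.norm_map, Complex.norm_real] at this
  have h2 := (le_max_right R (M + 1)).trans ((le_abs_self _).trans this)
  linarith

/-- Angles add along the walk while rotations multiply. For a closed walk the total rotation is
trivial, so the angle is 2π times an integer winding number. -/
lemma exists_walk_angle {u v : V} (w : G.Walk u v) :
    ∃ θ : Plane → ℝ, (∀ x, (∀ e ∈ w.edges, x ∉ D.arc e) → ContinuousAt θ x) ∧
      (∀ x, (∀ e ∈ w.edges, x ∉ D.arc e) → ∃ r : ℝ, 0 ≤ r ∧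
        r * Complex.exp (θ x * Complex.I) * (toComplex (D.point u) - toComplex x) =
        toComplex (D.point v) - toComplex x) ∧
      Tendsto θ (cocompact Plane) (𝓝 0) := by
  induction w with
  | nil =>
    exact ⟨fun _ => 0, fun x _ => continuousAt_const, fun x _ => ⟨1, zero_le_one, by simp⟩,
      tendsto_const_nhds⟩
  | @cons a b c h w ih =>
    obtain ⟨θ, h1, h2, h3⟩ := ih
    obtain ⟨θ', h1', h2', h3', -⟩ := (D.isPolygonalArc_arc a b h).exists_angle
    refine ⟨fun x => θ' x + θ x, ?_, ?_, by simpa using h3'.add h3⟩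
    · intro x hx
      simp only [SimpleGraph.Walk.edges_cons, List.mem_cons, forall_eq_or_imp] at hx
      exact (h1' x hx.1).add (h1 x hx.2)
    · intro x hx
      simp only [SimpleGraph.Walk.edges_cons, List.mem_cons, forall_eq_or_imp] at hx
      obtain ⟨r, hr, hr'⟩ := h2 x hx.2
      obtain ⟨s, hs, hs'⟩ := h2' x hx.1
      refine ⟨r * s, mul_nonneg hr hs, ?_⟩
      rw [← hr', ← hs']
      push_cast
      rw [add_mul, Complex.exp_add]
      ring

/-- A cycle has an inside. -/
lemma exists_bounded : ∃ z ∉ D.curve K,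
    Bornology.IsBounded (connectedComponentIn (D.curve K)ᶜ z) := by
  by_contra! hcon
  -- Here θ is 2π times the winding number, and it jumps by 2π across the first edge of the cycle.
  obtain ⟨θ, hcont, hint, hzero, x, hxK, n, hjump, hoff⟩ : ∃ θ : Plane → ℝ,
      (∀ x ∉ D.curve K, ContinuousAt θ x) ∧
      (∀ x ∉ D.curve K, ∃ k : ℤ, θ x = k * (2 * Real.pi)) ∧
      Tendsto θ (cocompact Plane) (𝓝 0) ∧
      ∃ x ∈ D.curve K, ∃ n : Plane,
        Tendsto (fun t : ℝ => θ (x + t • n) - θ (x - t • n)) (𝓝[>] 0) (𝓝 (2 * Real.pi)) ∧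
        ∀ᶠ t in 𝓝[>] (0 : ℝ), x + t • n ∉ D.curve K ∧ x - t • n ∉ D.curve K := by
    obtain ⟨base, walk, hcyc⟩ := K
    cases walk with
    | nil => exact absurd rfl hcyc.ne_nil
    | @cons _ b _ h w =>
      obtain ⟨θ', h1', h2', h3', x, hxA, hxa, hxb, n, hjump, hoff⟩ :=
        (D.isPolygonalArc_arc base b h).exists_angle
      obtain ⟨θ, h1, h2, h3⟩ := D.exists_walk_angle w
      have hmem : ∀ y, y ∉ D.curve ⟨base, .cons h w, hcyc⟩ ↔
          y ∉ D.arc s(base, b) ∧ ∀ e ∈ w.edges, y ∉ D.arc e := by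
        intro y
        simp [curve]
      have hxw : ∀ e ∈ w.edges, x ∉ D.arc e := by
        intro e he hxe
        have hnd := hcyc.edges_nodup
        rw [SimpleGraph.Walk.edges_cons, List.nodup_cons] at hnd
        obtain ⟨z, ⟨hz, -⟩, rfl⟩ := D.arc_inter_arc s(base, b) h e (w.edges_subset_edgeSet he)
          (fun h => hnd.1 (h ▸ he)) ⟨hxA, hxe⟩
        rcases Sym2.mem_iff.1 hz with rfl | rfl
        · exact hxa rfl
        · exact hxb rfl
      have hplus : Tendsto (fun t : ℝ => x + t • n) (𝓝[>] 0) (𝓝 x) := by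
        have : Continuous fun t : ℝ => x + t • n := by fun_prop
        simpa using (this.tendsto 0).mono_left nhdsWithin_le_nhds
      have hminus : Tendsto (fun t : ℝ => x - t • n) (𝓝[>] 0) (𝓝 x) := by
        have : Continuous fun t : ℝ => x - t • n := by fun_prop
        simpa using (this.tendsto 0).mono_left nhdsWithin_le_nhds
      refine ⟨fun y => θ' y + θ y, ?_, ?_, by simpa using h3'.add h3, x, ?_, n, ?_, ?_⟩
      · intro y hy
        rw [hmem] at hy
        exact (h1' y hy.1).add (h1 y hy.2)
      · intro y hy
        have hybase : toComplex (D.point base) - toComplex y ≠ 0 := by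
          rw [sub_ne_zero]
          intro heq
          rw [← toComplex.injective heq, D.point_mem_curve_iff] at hy
          exact hy (SimpleGraph.Walk.start_mem_support _)
        rw [hmem] at hy
        obtain ⟨r, hr, hr'⟩ := h2 y hy.2
        obtain ⟨s, hs, hs'⟩ := h2' y hy.1
        have hone : ((r * s : ℝ) : ℂ) * Complex.exp ((θ' y + θ y : ℝ) * Complex.I) = 1 := by
          apply mul_right_cancel₀ hybase
          rw [one_mul]
          conv_rhs => rw [← hr', ← hs']
          push_cast
          rw [add_mul, Complex.exp_add]
          ring
        have hrs : r * s = 1 := by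
          have := congrArg norm hone
          rw [norm_mul, Complex.norm_exp_ofReal_mul_I, Complex.norm_real, mul_one, norm_one,
            Real.norm_eq_abs, abs_of_nonneg (mul_nonneg hr hs)] at this
          exact this
        rw [hrs, Complex.ofReal_one, one_mul, Complex.exp_eq_one_iff] at hone
        obtain ⟨k, hk⟩ := hone
        refine ⟨k, ?_⟩
        rw [← mul_assoc] at hk
        exact_mod_cast mul_right_cancel₀ Complex.I_ne_zero hk
      · exact D.arc_subset_curve (K := ⟨base, .cons h w, hcyc⟩) (by simp) hxA
      · have hc := h1 x hxw
        have := hjump.add ((hc.tendsto.comp hplus).sub (hc.tendsto.comp hminus))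
        rw [sub_self, add_zero] at this
        refine this.congr fun t => ?_
        simp only [Function.comp_apply]
        ring
      · have hcl : IsClosed (⋃ e ∈ {e | e ∈ w.edges}, D.arc e) :=
          (List.finite_toSet w.edges).isClosed_biUnion fun e he =>
            (D.isCompact_arc (w.edges_subset_edgeSet he)).isClosed
        have hxc : x ∈ (⋃ e ∈ {e | e ∈ w.edges}, D.arc e)ᶜ := by
          simp only [mem_compl_iff, mem_iUnion, not_exists]
          exact hxw
        have hev := hcl.isOpen_compl.mem_nhds hxc
        filter_upwards [hoff, hplus.eventually_mem hev, hminus.eventually_mem hev]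
          with t ht h2 h3
        simp only [mem_compl_iff, mem_iUnion, not_exists] at h2 h3
        exact ⟨(hmem _).2 ⟨ht.1, h2⟩, (hmem _).2 ⟨ht.2, h3⟩⟩
  -- On an unbounded component |θ| drops below π somewhere. A nonzero value is at least 2π in
  -- absolute value, so |θ| would also equal π, which is no multiple of 2π.
  have hvanish : ∀ z ∉ D.curve K, θ z = 0 := by
    intro z hz
    by_contra hne
    obtain ⟨k, hk⟩ := hint z hz
    have hk1 : (1 : ℝ) ≤ |(k : ℝ)| := by
      have : k ≠ 0 := by
        rintro rfl
        exact hne (by simpa using hk)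
      exact_mod_cast Int.one_le_abs this
    have hπ := Real.pi_pos
    have hev : ∀ᶠ y in cocompact Plane, |θ y| < Real.pi := by
      have := hzero.abs
      rw [abs_zero] at this
      exact this.eventually (gt_mem_nhds hπ)
    rw [← Metric.cobounded_eq_cocompact] at hev
    obtain ⟨y, hyU, hy⟩ : ∃ y ∈ connectedComponentIn (D.curve K)ᶜ z, |θ y| < Real.pi := by
      by_contra! hcon'
      refine hcon z hz ((Bornology.isBounded_def.2 ?_))
      filter_upwards [hev] with y hy hyU
      exact absurd (hcon' y hyU) (not_le.2 hy)
    have hsub := connectedComponentIn_subset (D.curve K)ᶜ z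
    have hcts : ContinuousOn (fun y => |θ y|) (connectedComponentIn (D.curve K)ᶜ z) :=
      fun y hy => ((hcont y (hsub hy)).abs).continuousWithinAt
    have hzπ : Real.pi ≤ |θ z| := by
      rw [hk, abs_mul, abs_of_pos (by positivity : (0 : ℝ) < 2 * Real.pi)]
      nlinarith
    obtain ⟨c, hcU, hc⟩ := isPreconnected_connectedComponentIn.intermediate_value hyU
      (mem_connectedComponentIn (F := (D.curve K)ᶜ) hz) hcts ⟨hy.le, hzπ⟩
    obtain ⟨l, hl⟩ := hint c (hsub hcU)
    simp only [hl, abs_mul, abs_of_pos (by positivity : (0 : ℝ) < 2 * Real.pi)] at hc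
    have h2 : |(l : ℝ)| * 2 = 1 := by
      apply mul_right_cancel₀ hπ.ne'
      linarith
    have h3 : |l| * 2 = 1 := by exact_mod_cast h2
    omega
  have hlim : Tendsto (fun t : ℝ => θ (x + t • n) - θ (x - t • n)) (𝓝[>] 0) (𝓝 0) := by
    refine tendsto_const_nhds.congr' ?_
    filter_upwards [hoff] with t ht
    rw [hvanish _ ht.1, hvanish _ ht.2, sub_zero]
  have := tendsto_nhds_unique hjump hlim
  have hπ := Real.pi_pos
  linarith

variable {K} in
/-- An edge from a vertex off a cycle stays on one side of the cycle until it meets it. -/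
lemma connectedComponentIn_eq_of_mem_arc {u w : V} (h : s(u, w) ∈ G.edgeSet) (hu : u ∉ K.verts)
    {z : Plane} (hz : z ∈ D.arc s(u, w)) (hzK : z ∉ D.curve K) :
    connectedComponentIn (D.curve K)ᶜ (D.point u) = connectedComponentIn (D.curve K)ᶜ z := by
  have harc := D.isPolygonalArc h
  -- Edges meet only at common ends and u is off the cycle, so w is the only possible meeting point.
  have hsub : D.arc s(u, w) ∩ D.curve K ⊆ {D.point w} := by
    rintro y ⟨hy, hyK⟩
    obtain ⟨e, he, hye⟩ := mem_iUnion₂.1 hyK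
    have hue : u ∉ e := fun hue => hu (K.mem_verts_of_mem_edge he hue)
    obtain ⟨v, ⟨hv, hv'⟩, rfl⟩ := D.arc_inter_arc _ h e (K.edges_subset he)
      (fun heq => hue (heq ▸ Sym2.mem_mk_left u w)) ⟨hy, hye⟩
    rcases Sym2.mem_iff.1 hv with rfl | rfl
    · exact absurd hv' hue
    · rfl
  by_cases hw : D.point w ∈ D.curve K
  · refine connectedComponentIn_eq (harc.isPreconnected_diff_right.subset_connectedComponentIn
      ⟨harc.left_mem, harc.ne⟩ ?_ ⟨hz, fun h => hzK (h ▸ hw)⟩)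
    exact fun y hy hyK => hy.2 (hsub ⟨hy.1, hyK⟩)
  · refine connectedComponentIn_eq (harc.isPreconnected.subset_connectedComponentIn
      harc.left_mem ?_ hz)
    exact fun y hy hyK => hw (hsub ⟨hy, hyK⟩ ▸ hyK)

end PlaneDrawing
end Drawings

/-! ### Relative position of two cycles. -/

section Sides

variable {V : Type*} {G : SimpleGraph V} (D : PlaneDrawing G) {C C' K : Cycle G}

namespace PlaneDrawing

lemma mem_interiorVerts_iff {v : V} : v ∈ D.interiorVerts K ↔ v ∉ K.verts ∧
    Bornology.IsBounded (connectedComponentIn (D.curve K)ᶜ (D.point v)) := by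
  rw [← D.point_mem_curve_iff K]
  rfl

lemma mem_interiorVerts_of_adj {u w : V} (h : G.Adj u w) (hu : u ∈ D.interiorVerts K)
    (hw : w ∉ K.verts) : w ∈ D.interiorVerts K := by
  rw [mem_interiorVerts_iff] at hu ⊢
  refine ⟨hw, ?_⟩
  rw [← D.connectedComponentIn_eq_of_mem_arc (u := u) (w := w) h hu.1
    (D.point_mem_arc (e := s(u, w)) h (Sym2.mem_mk_right u w))
    (by rwa [D.point_mem_curve_iff])]
  exact hu.2

/-- If no vertex of `C'` is inside `C`, then `C` does not pass from the inside to the outside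
of `C'`. -/
lemma mem_interiorVerts_of_disjoint (hE : ∀ e ∈ C'.walk.edges, ∃ w ∈ e, w ∉ C.verts)
    (hno : C'.verts ∩ D.interiorVerts C = ∅) {x y : V} (hx : x ∈ C.verts)
    (hx' : x ∈ D.interiorVerts C') (hy : y ∈ C.verts) (hy' : y ∉ C'.verts) :
    y ∈ D.interiorVerts C' := by
  obtain ⟨z, hz, hb⟩ := D.exists_bounded C
  set W := connectedComponentIn (D.curve C)ᶜ z with hW
  -- An edge of C' entering W would have its end off C in W too, giving a vertex of C' inside C.
  have hWC' : W ⊆ (D.curve C')ᶜ := by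
    intro p hp hpC'
    obtain ⟨e, he, hpe⟩ := mem_iUnion₂.1 hpC'
    obtain ⟨w, hwe, hw⟩ := hE e he
    have hw' := C'.mem_verts_of_mem_edge he hwe
    obtain ⟨b, rfl⟩ := Sym2.mem_iff_exists.1 hwe
    have h1 := D.connectedComponentIn_eq_of_mem_arc (C'.edges_subset he) hw hpe
      (connectedComponentIn_subset _ _ hp)
    rw [hW, connectedComponentIn_eq hp, ← h1] at hb
    exact (hno.subset ⟨hw', D.mem_interiorVerts_iff.2 ⟨hw, hb⟩⟩ : w ∈ (∅ : Set V))
  -- Each vertex of C is in the closure of W, and W is connected and avoids C'; hence all those off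
  -- C' share one component with W.
  have key : ∀ v ∈ C.verts, v ∉ C'.verts → ∀ p ∈ W,
      connectedComponentIn (D.curve C')ᶜ (D.point v) =
        connectedComponentIn (D.curve C')ᶜ p := by
    intro v hv hv' p hp
    have hvC' : D.point v ∈ (D.curve C')ᶜ := by
      rwa [mem_compl_iff, D.point_mem_curve_iff]
    obtain ⟨q, hq, hqW⟩ := mem_closure_iff.1
      (D.curve_subset_closure C hz ((D.point_mem_curve_iff C).2 hv)) _
      (D.isCompact_curve C').isClosed.isOpen_compl.connectedComponentIn
      (mem_connectedComponentIn hvC')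
    rw [connectedComponentIn_eq hq]
    exact connectedComponentIn_eq (isPreconnected_connectedComponentIn.subset_connectedComponentIn
      hqW hWC' hp)
  have hzW : z ∈ W := mem_connectedComponentIn (F := (D.curve C)ᶜ) hz
  rw [mem_interiorVerts_iff] at hx' ⊢
  refine ⟨hy', ?_⟩
  rw [key y hy hy' z hzW, ← key x hx hx'.1 z hzW]
  exact hx'.2

/-- If every edge of `C` has an end inside `C'`, then no vertex of `C'` is inside `C`. -/
lemma inter_interiorVerts_eq_empty
    (hE : ∀ e ∈ C.walk.edges, ∃ u ∈ e, u ∈ D.interiorVerts C') :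
    C'.verts ∩ D.interiorVerts C = ∅ := by
  rw [eq_empty_iff_forall_notMem]
  rintro v ⟨hv, hvC⟩
  obtain ⟨z, hz, hb⟩ := D.exists_unbounded C'
  set U := connectedComponentIn (D.curve C')ᶜ z with hU
  -- A point of C in U would share its component with the inside end of its edge, which is bounded
  -- while U is not.
  have hUC : U ⊆ (D.curve C)ᶜ := by
    intro p hp hpC
    obtain ⟨e, he, hpe⟩ := mem_iUnion₂.1 hpC
    obtain ⟨u, hue, hu⟩ := hE e he
    obtain ⟨b, rfl⟩ := Sym2.mem_iff_exists.1 hue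
    rw [mem_interiorVerts_iff] at hu
    have h1 := D.connectedComponentIn_eq_of_mem_arc (C.edges_subset he) hu.1 hpe
      (connectedComponentIn_subset _ _ hp)
    rw [hU, connectedComponentIn_eq hp, ← h1] at hb
    exact hb hu.2
  have hvU := D.curve_subset_closure C' hz ((D.point_mem_curve_iff C').2 hv)
  have hpre : IsPreconnected (insert (D.point v) U) :=
    isPreconnected_connectedComponentIn.subset_closure (subset_insert _ _)
      (insert_subset hvU subset_closure)
  have hsub := hpre.subset_connectedComponentIn (mem_insert _ _) (insert_subset hvC.1 hUC)
  exact hb (hvC.2.subset ((subset_insert _ _).trans hsub))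

/-- A cycle disjoint from `C'` lies on one side of it. -/
lemma mem_interiorVerts_of_disjoint_verts (hd : Disjoint C.verts C'.verts) {x y : V}
    (hx : x ∈ C.verts) (hx' : x ∈ D.interiorVerts C') (hy : y ∈ C.verts) :
    y ∈ D.interiorVerts C' := by
  have hCC' : D.curve C ⊆ (D.curve C')ᶜ := by
    intro p hp hp'
    obtain ⟨e, he, hpe⟩ := mem_iUnion₂.1 hp
    obtain ⟨e', he', hpe'⟩ := mem_iUnion₂.1 hp'
    have hne : ∀ w ∈ e, w ∉ e' := fun w hw hw' => disjoint_left.1 hd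
      (C.mem_verts_of_mem_edge he hw) (C'.mem_verts_of_mem_edge he' hw')
    obtain ⟨w, ⟨hw, hw'⟩, -⟩ := D.arc_inter_arc e (C.edges_subset he) e' (C'.edges_subset he')
      (by
        rintro rfl
        induction e with
        | _ a b => exact hne a (Sym2.mem_mk_left a b) (Sym2.mem_mk_left a b))
      ⟨hpe, hpe'⟩
    exact hne w hw hw'
  have h := (D.isPreconnected_curve C).subset_connectedComponentIn
    ((D.point_mem_curve_iff C).2 hx) hCC' ((D.point_mem_curve_iff C).2 hy)
  rw [mem_interiorVerts_iff] at hx' ⊢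
  refine ⟨disjoint_left.1 hd hy, ?_⟩
  rw [← connectedComponentIn_eq h]
  exact hx'.2

end PlaneDrawing
end Sides

/-! ### Effect of σ-operations on bichromatic cycles. -/

section Colors

variable {V : Type*} {G : SimpleGraph V} (D : PlaneDrawing G) {f : G.Coloring (Fin 4)}
  {C C' K : Cycle G}

lemma mem_colorsOn {v : V} (hv : v ∈ K.verts) : f v ∈ colorsOn f K := ⟨v, hv, rfl⟩

lemma IsBichromatic.exists_mem_edge (hK : IsBichromatic f K) {b : Fin 4} (hb : b ∈ colorsOn f K)
    {e : Sym2 V} (he : e ∈ K.walk.edges) : ∃ u ∈ e, f u = b := by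
  obtain ⟨c, d, -, hcd⟩ := ncard_eq_two.1 hK
  induction e with
  | _ p q =>
    have hp := mem_colorsOn (f := f) (K.mem_verts_of_mem_edge he (Sym2.mem_mk_left p q))
    have hq := mem_colorsOn (f := f) (K.mem_verts_of_mem_edge he (Sym2.mem_mk_right p q))
    have hpq : f p ≠ f q := f.valid (K.edges_subset he)
    have : f p = b ∨ f q = b := by
      simp only [hcd, mem_insert_iff, mem_singleton_iff] at hp hq hb
      grind
    rcases this with h | h
    · exact ⟨p, Sym2.mem_mk_left p q, h⟩
    · exact ⟨q, Sym2.mem_mk_right p q, h⟩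

lemma IsBichromatic.exists_mem_notMem (h : IsBichromatic f C) (h' : IsBichromatic f C')
    (hne : colorsOn f C ≠ colorsOn f C') : ∃ b ∈ colorsOn f C, b ∉ colorsOn f C' := by
  by_contra! hcon
  exact hne (eq_of_subset_of_ncard_le hcon (by rw [h, h']))

lemma exists_compl_eq_pair (h : IsBichromatic f C) :
    ∃ s t : Fin 4, s ≠ t ∧ (colorsOn f C)ᶜ = {s, t} := by
  have h1 := ncard_add_ncard_compl (colorsOn f C)
  rw [h, Nat.card_eq_fintype_card, Fintype.card_fin] at h1
  exact ncard_eq_two.1 (by omega)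

lemma colorsOn_comp {f' : G.Coloring (Fin 4)} {π : Equiv.Perm (Fin 4)}
    (h : ∀ v ∈ K.verts, f' v = π (f v)) : colorsOn f' K = π '' colorsOn f K := by
  rw [colorsOn, colorsOn, image_image]
  exact image_congr h

lemma swap_apply_of_mem_colorsOn {s t c : Fin 4} (hst : (colorsOn f K)ᶜ = {s, t})
    (hc : c ∈ colorsOn f K) : Equiv.swap s t c = c := by
  have h : c ∉ ({s, t} : Set (Fin 4)) := hst ▸ notMem_compl_iff.2 hc
  simp only [mem_insert_iff, mem_singleton_iff, not_or] at h
  exact Equiv.swap_apply_of_ne_of_ne h.1 h.2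

namespace PlaneDrawing

/-- A conflict could only arise on an edge leaving the interior. Its other end lies on K, where the
interchange fixes every colour. -/
lemma exists_isSigma (h : IsBichromatic f K) : ∃ g, D.IsSigma f K g := by
  classical
  obtain ⟨s, t, hst, hK⟩ := exists_compl_eq_pair h
  let g : V → Fin 4 := fun v => if v ∈ D.interiorVerts K then Equiv.swap s t (f v) else f v
  have hg : ∀ u v, G.Adj u v → u ∈ D.interiorVerts K → g u ≠ g v := by
    intro u v huv hu
    have hne := f.valid huv
    by_cases hv : v ∈ D.interiorVerts K
    · simp only [g, hu, hv, if_true]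
      exact (Equiv.swap s t).injective.ne hne
    · have hvK : v ∈ K.verts := by
        by_contra hvK
        exact hv (D.mem_interiorVerts_of_adj huv hu hvK)
      simp only [g, hu, hv, if_true, if_false]
      rw [← swap_apply_of_mem_colorsOn hK (mem_colorsOn hvK)]
      exact (Equiv.swap s t).injective.ne hne
  refine ⟨SimpleGraph.Coloring.mk g ?_, h, s, t, hst, hK, fun v => ⟨fun hv => if_pos hv,
    fun hv => if_neg hv⟩⟩
  intro u v huv
  by_cases hu : u ∈ D.interiorVerts K
  · exact hg u v huv hu
  by_cases hv : v ∈ D.interiorVerts K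
  · exact (hg v u huv.symm hv).symm
  · simp only [g, hu, hv, if_false]
    exact f.valid huv

/-- Bichromatic cycles that stay bichromatic do not intersect cycles with other colours. -/
lemma not_intersecting_of_isSigma (hC : IsBichromatic f C) (hC' : IsBichromatic f C')
    (hne : colorsOn f C ≠ colorsOn f C')
    (hstay : ∀ g, D.IsSigma f C' g → IsBichromatic g C) : ¬ D.Intersecting C C' := by
  rintro ⟨⟨x, hx, hx'⟩, hv⟩
  obtain ⟨b, hb, hb'⟩ := hC.exists_mem_notMem hC' hne
  have hoff : ∀ y, f y = b → y ∉ C'.verts := fun y hy hyC' => hb' (hy ▸ mem_colorsOn hyC')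
  suffices hin : ∀ y ∈ C.verts, f y = b → y ∈ D.interiorVerts C' by
    refine hv.ne_empty (D.inter_interiorVerts_eq_empty fun e he => ?_)
    obtain ⟨u, hue, hu⟩ := hC.exists_mem_edge hb he
    exact ⟨u, hue, hin u (C.mem_verts_of_mem_edge he hue) hu⟩
  intro y hy hyb
  by_contra hyint
  -- If x itself is not coloured b, its neighbour on C is; that neighbour is off C', hence inside
  -- with x.
  obtain ⟨x', hx'C, hx'int, hx'b⟩ : ∃ x' ∈ C.verts, x' ∈ D.interiorVerts C' ∧ f x' = b := by
    obtain ⟨w, -, -, hw, -⟩ := C.exists_two_edges hx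
    obtain ⟨u, hu, hub⟩ := hC.exists_mem_edge hb hw
    refine ⟨u, C.mem_verts_of_mem_edge hw hu, ?_, hub⟩
    rcases Sym2.mem_iff.1 hu with rfl | rfl
    · exact hx'
    · exact D.mem_interiorVerts_of_adj (C.edges_subset hw) hx' (hoff _ hub)
  by_cases hd : Disjoint (colorsOn f C) (colorsOn f C')
  · refine hyint (D.mem_interiorVerts_of_disjoint_verts ?_ hx'C hx'int hy)
    rw [disjoint_left] at hd ⊢
    exact fun z hz hz' => hd (mem_colorsOn hz) (mem_colorsOn hz')
  -- After σ at C', the vertices z, y and x' of C carry three different colours: the shared one, b,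
  -- and the interchange partner of b.
  obtain ⟨a, ⟨z, hz, rfl⟩, ha⟩ := not_disjoint_iff.1 hd
  obtain ⟨g, hg⟩ := D.exists_isSigma hC'
  have hgC := hstay g hg
  obtain ⟨-, s, t, hst, hK, hg⟩ := hg
  have hgz : g z = f z := by
    by_cases hzint : z ∈ D.interiorVerts C'
    · rw [(hg z).1 hzint, swap_apply_of_mem_colorsOn hK ha]
    · exact (hg z).2 hzint
  have hgy : g y = b := by rw [(hg y).2 hyint, hyb]
  have hgx : g x' = Equiv.swap s t b := by rw [(hg x').1 hx'int, hx'b]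
  have hbst : b = s ∨ b = t := by
    have : b ∈ (colorsOn f C')ᶜ := hb'
    rwa [hK] at this
  have hbd : Equiv.swap s t b ≠ b := by
    rcases hbst with rfl | rfl
    · rw [Equiv.swap_apply_left]
      exact hst.symm
    · rw [Equiv.swap_apply_right]
      exact hst
  have hab : f z ≠ b := fun h => hb' (h ▸ ha)
  have had : f z ≠ Equiv.swap s t b := by
    rw [← swap_apply_of_mem_colorsOn hK ha]
    exact (Equiv.swap s t).injective.ne hab
  have hz' := mem_colorsOn (f := g) hz
  have hy' := mem_colorsOn (f := g) hy
  have hx'' := mem_colorsOn (f := g) hx'C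
  rw [hgz] at hz'
  rw [hgy] at hy'
  rw [hgx] at hx''
  obtain ⟨c, d, -, hcd⟩ := ncard_eq_two.1 hgC
  simp only [hcd, mem_insert_iff, mem_singleton_iff] at hz' hy' hx''
  grind

/-- A bichromatic cycle stays bichromatic under a `σ`-operation at a cycle that has the same
colours or does not intersect it. -/
lemma IsSigma.isBichromatic {D : PlaneDrawing G} {g : G.Coloring (Fin 4)}
    (hg : D.IsSigma f C' g) (hC : IsBichromatic f C)
    (h : colorsOn f C' ≠ colorsOn f C → ¬ D.Intersecting C C') : IsBichromatic g C := by
  obtain ⟨hC', s, t, -, hK, hg⟩ := hg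
  have same : (∀ v ∈ C.verts, g v = f v) → IsBichromatic g C := by
    intro hgf
    rw [IsBichromatic, colorsOn_comp (π := 1) (f := f) (by simpa using hgf)]
    simpa [IsBichromatic] using hC
  by_cases hne : colorsOn f C' = colorsOn f C
  · apply same
    intro v hv
    by_cases hvint : v ∈ D.interiorVerts C'
    · rw [(hg v).1 hvint, swap_apply_of_mem_colorsOn hK (hne ▸ mem_colorsOn hv)]
    · exact (hg v).2 hvint
  by_cases hx : ∃ x ∈ C.verts, x ∈ D.interiorVerts C'
  · obtain ⟨x, hx, hx'⟩ := hx
    obtain ⟨c, hc, hc'⟩ := hC'.exists_mem_notMem hC hne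
    have hno : C'.verts ∩ D.interiorVerts C = ∅ := by
      by_contra hcon
      exact h hne ⟨⟨x, hx, hx'⟩, nonempty_iff_ne_empty.2 hcon⟩
    have hE : ∀ e ∈ C'.walk.edges, ∃ w ∈ e, w ∉ C.verts := by
      intro e he
      obtain ⟨u, hu, huc⟩ := hC'.exists_mem_edge hc he
      exact ⟨u, hu, fun huC => hc' (huc ▸ mem_colorsOn huC)⟩
    -- On C the operation is the interchange of s and t throughout: vertices off C' are all inside
    -- it, and those on C' have colours that the interchange fixes.
    rw [IsBichromatic, colorsOn_comp (π := Equiv.swap s t) (f := f) fun v hv => ?_,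
      ncard_image_of_injective _ (Equiv.swap s t).injective]
    · exact hC
    · by_cases hvC' : v ∈ C'.verts
      · rw [swap_apply_of_mem_colorsOn hK (mem_colorsOn hvC')]
        exact (hg v).2 fun hvint => (D.mem_interiorVerts_iff.1 hvint).1 hvC'
      · exact (hg v).1 (D.mem_interiorVerts_of_disjoint hE hno hx hx' hv hvC')
  · exact same fun v hv => (hg v).2 fun hvint => hx ⟨v, hv, hvint⟩

end PlaneDrawing
end Colors
end KempeCycle

/-! ### The equivalence, by passing along chains of σ-operations. -/

theorem mainTheorem6 {V : Type*} [Fintype V] (G : SimpleGraph V) [DecidableRel G.Adj]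
    (hG : KempeCycle.IsMaximalPlanar G) (hχ : G.chromaticNumber = 4) (hδ : 4 ≤ G.minDegree)
    (D : KempeCycle.PlaneDrawing G)
    (f : G.Coloring (Fin 4)) (C : KempeCycle.Cycle G) (hC : KempeCycle.IsBichromatic f C) :
    D.IsUBCycle f C ↔
      ∀ f' ∈ D.kempeClass f, ∀ C' : KempeCycle.Cycle G, KempeCycle.IsBichromatic f' C' →
        KempeCycle.colorsOn f' C' ≠ KempeCycle.colorsOn f' C → ¬ D.Intersecting C C' := by
  constructor
  · rintro ⟨-, hUB⟩ f' ⟨h, hfh, π, hπ⟩ C' hC' hne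
    have hcol : ∀ K : KempeCycle.Cycle G,
        KempeCycle.colorsOn f' K = π '' KempeCycle.colorsOn h K :=
      fun K => KempeCycle.colorsOn_comp fun v _ => hπ v
    -- A renaming of colours changes neither bichromaticity nor the inequality of colour sets, so f'
    -- may be replaced by the coloring h that σ-operations reach.
    rw [KempeCycle.IsBichromatic, hcol, Set.ncard_image_of_injective _ π.injective] at hC'
    rw [hcol, hcol] at hne
    refine D.not_intersecting_of_isSigma (hUB h ⟨h, hfh, 1, fun _ => rfl⟩) hC'
      (fun heq => hne (congrArg _ heq.symm)) fun g hg => ?_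
    exact hUB g ⟨g, hfh.tail ⟨C', hg⟩, 1, fun _ => rfl⟩
  · intro H
    have hchain : ∀ h, Relation.ReflTransGen (fun f₁ f₂ => ∃ C, D.IsSigma f₁ C f₂) f h →
        KempeCycle.IsBichromatic h C := by
      intro h hfh
      induction hfh with
      | refl => exact hC
      | @tail h g hfh hstep ih =>
        obtain ⟨C', hg⟩ := hstep
        exact hg.isBichromatic ih (H h ⟨h, hfh, 1, fun _ => rfl⟩ C' hg.1)
    refine ⟨hC, ?_⟩
    rintro f' ⟨h, hfh, π, hπ⟩
    rw [KempeCycle.colorsOn_comp fun v _ => hπ v, Set.ncard_image_of_injective _ π.injective]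
    exact hchain h hfh
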